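/- A one-counter process $\mathcal O=(Q,\{Q_p\}_{p\in\mathcal P},\delta_0,\delta_{>0})$ over a set $\mathcal P$ of atomic propositions consists of a finite set $Q$ of control locations, sets $Q_p\subseteq Q$ (all but finitely many of them empty), zero transitions $\delta_0\subseteq Q\times\{0,1\}\times Q$ and positive transitions $\delta_{>0}\subseteq Q\times\{-1,0,1\}\times Q$. It is a one-counter net if $\delta_0\subseteq\delta_{>0}$. Its transition system $T(\mathcal O)$ has the states $Q\times\mathbb N$; proposition $p$ holds in $Q_p\times\mathbb N$; and $(q,n)\to(q',n+k)$ iff either $n=0$ and $(q,k,q')\in\delta_0$, or $n>0$ and $(q,k,q')\in\delta_{>0}$. CTL formulas are given by $\varphi::=p\mid\neg\varphi\mid\varphi\wedge\varphi\mid\exists\mathsf X\varphi\mid\exists\varphi\,\mathsf U\,\varphi\mid\exists\varphi\,\mathsf{WU}\,\varphi$ with $p\in\mathcal P$. They have the usual semantics: $\exists\varphi_1\mathsf U\varphi_2$ asks for a finite path whose last state satisfies $\varphi_2$ and all of whose earlier states satisfy $\varphi_1$, and $\exists\varphi_1\mathsf{WU}\varphi_2$ holds if $\exists\varphi_1\mathsf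 U\varphi_2$ holds or there is an infinite path all of whose states satisfy $\varphi_1$. Let $\mathcal O$ be the following fixed one-counter process. Its control locations are $t,\bar t,q_0,q_1,q_2,q_3,f,g,p_0,p_1$; these are also the atomic propositions, each one holding exactly in the control location of the same name. Writing $q\xrightarrow{k}q'$ for $(q,k,q')$, the zero transitions $\delta_0$ are $$t\xrightarrow{0}q_0,\quad t\xrightarrow{0}f,\quad \bar t\xrightarrow{+1}p_1,\quad \bar t\xrightarrow{0}p_0,\quad p_0\xrightarrow{0}\bar t,$$ and the positive transitions $\delta_{>0}$ are these five together with $$q_0\xrightarrow{-1}q_1,\ q_1\xrightarrow{-1}q_2,\ q_2\xrightarrow{-1}q_3,\ q_3\xrightarrow{-1}q_0,\ q_1\xrightarrow{-1}q_1,\ q_3\xrightarrow{-1}q_3,$$ $$q_0\xrightarrow{0}t,\ q_2\xrightarrow{0}t,\ q_1\xrightarrow{0}\bar t,\ q_3\xrightarrow{0}\bar t,\ \bar t\xrightarrow{0}q_1,\ \bar t\xrightarrow{0}q_2,\ \bar t\xrightarrow{0}q_3,$$ $$\bar t\xrightarrow{-1}f,\ f\xrightarrow{-1}g,\ g\xrightarrow{-1}f,\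 p_1\xrightarrow{+1}p_1,\ p_1\xrightarrow{0}\bar t.$$ **Theorem.** $\mathcal O$ is a one-counter net, and CTL model checking of the fixed net $\mathcal O$ is $\mathsf{PSPACE}$-hard, even in the fixed state $(\bar t,0)$: for every language $L\subseteq\{0,1\}^*$ in $\mathsf{PSPACE}$ there is a polynomial-time computable function $x\mapsto\varphi_x$ from $\{0,1\}^*$ to CTL formulas (written as words) such that $x\in L$ if and only if $(\bar t,0)$ satisfies $\varphi_x$ in $T(\mathcal O)$. -/

import Mathlib

/-! ### Transition systems and the logic CTL -/

/-- A transition system over the atomic propositions `P`; only finitely many propositions hold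
anywhere. -/
structure TransitionSystem (P : Type) where
  State : Type
  label : P → Set State
  finite_label : {p | (label p).Nonempty}.Finite
  step : State → State → Prop

/-- Formulas of CTL: `p`, `¬φ`, `φ ∧ ψ`, `∃X φ`, `∃ φ U ψ`, `∃ φ WU ψ`. -/
inductive CTL (P : Type) where
  | atom (p : P) : CTL P
  | neg (φ : CTL P) : CTL P
  | conj (φ ψ : CTL P) : CTL P
  | exX (φ : CTL P) : CTL P
  | exU (φ ψ : CTL P) : CTL P
  | exWU (φ ψ : CTL P) : CTL P

namespace CTL

/-- The set of states of `T` in which a formula holds. A finite path with `k + 1` states is given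
by the first `k + 1` values of a sequence `π`; the later values are irrelevant. -/
def sem {P : Type} (T : TransitionSystem P) : CTL P → Set T.State
  | atom p => T.label p
  | neg φ => (sem T φ)ᶜ
  | conj φ ψ => sem T φ ∩ sem T ψ
  | exX φ => {s | ∃ s' ∈ sem T φ, T.step s s'}
  | exU φ ψ => {s | ∃ (k : ℕ) (π : ℕ → T.State), π 0 = s ∧ (∀ i < k, T.step (π i) (π (i + 1))) ∧
      π k ∈ sem T ψ ∧ ∀ i < k, π i ∈ sem T φ}
  | exWU φ ψ => {s | ∃ (k : ℕ) (π : ℕ → T.State), π 0 = s ∧ (∀ i < k, T.step (π i) (π (i + 1))) ∧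
      π k ∈ sem T ψ ∧ ∀ i < k, π i ∈ sem T φ} ∪
      {s | ∃ π : ℕ → T.State, π 0 = s ∧ (∀ i, T.step (π i) (π (i + 1))) ∧ ∀ i, π i ∈ sem T φ}

/-- The size of a formula. -/
def size {P : Type} : CTL P → ℕ
  | atom _ => 1
  | neg φ => size φ + 1
  | conj φ ψ => size φ + size ψ + 1
  | exX φ => size φ + 1
  | exU φ ψ => size φ + size ψ + 1
  | exWU φ ψ => size φ + size ψ + 1

/-- The alphabet in which formulas are written down: one letter for each atomic proposition and
one for each connective. -/
inductive Token (P : Type) where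
  | atom (p : P) : Token P
  | neg : Token P
  | conj : Token P
  | exX : Token P
  | exU : Token P
  | exWU : Token P

/-- A formula as a word, in prefix notation. -/
def encode {P : Type} : CTL P → List (Token P)
  | atom p => [Token.atom p]
  | neg φ => Token.neg :: encode φ
  | conj φ ψ => Token.conj :: (encode φ ++ encode ψ)
  | exX φ => Token.exX :: encode φ
  | exU φ ψ => Token.exU :: (encode φ ++ encode ψ)
  | exWU φ ψ => Token.exWU :: (encode φ ++ encode ψ)

theorem length_encode {P : Type} (φ : CTL P) : (encode φ).length = size φ := by
  induction φ <;> simp_all [encode, size]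

theorem encode_append_inj {P : Type} (φ : CTL P) :
    ∀ (ψ : CTL P) (l l' : List (Token P)), encode φ ++ l = encode ψ ++ l' → φ = ψ ∧ l = l' := by
  induction φ with
  | atom p => intro ψ l l' h; cases ψ <;> simp_all [encode]
  | neg φ ih =>
    intro ψ l l' h
    cases ψ <;> simp [encode] at h
    obtain ⟨rfl, rfl⟩ := ih _ _ _ h
    exact ⟨rfl, rfl⟩
  | exX φ ih =>
    intro ψ l l' h
    cases ψ <;> simp [encode] at h
    obtain ⟨rfl, rfl⟩ := ih _ _ _ h
    exact ⟨rfl, rfl⟩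
  | conj φ₁ φ₂ ih₁ ih₂ =>
    intro ψ l l' h
    cases ψ <;> simp [encode] at h
    obtain ⟨rfl, h'⟩ := ih₁ _ _ _ h
    obtain ⟨rfl, rfl⟩ := ih₂ _ _ _ h'
    exact ⟨rfl, rfl⟩
  | exU φ₁ φ₂ ih₁ ih₂ =>
    intro ψ l l' h
    cases ψ <;> simp [encode] at h
    obtain ⟨rfl, h'⟩ := ih₁ _ _ _ h
    obtain ⟨rfl, rfl⟩ := ih₂ _ _ _ h'
    exact ⟨rfl, rfl⟩
  | exWU φ₁ φ₂ ih₁ ih₂ =>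
    intro ψ l l' h
    cases ψ <;> simp [encode] at h
    obtain ⟨rfl, h'⟩ := ih₁ _ _ _ h
    obtain ⟨rfl, rfl⟩ := ih₂ _ _ _ h'
    exact ⟨rfl, rfl⟩

/-- Distinct formulas have distinct encodings. -/
theorem encode_injective {P : Type} : Function.Injective (encode (P := P)) := fun φ ψ h =>
  (encode_append_inj φ ψ [] [] (by simpa using h)).1

end CTL

/-! ### One-counter processes and nets -/

/-- A one-counter process over the atomic propositions `P`. -/
structure OneCounterProcess (P : Type) where
  /-- control locations -/
  Q : Type
  [finQ : Fintype Q]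
  label : P → Set Q
  finite_label : {p | (label p).Nonempty}.Finite
  /-- zero transitions -/
  δ₀ : Set (Q × ℤ × Q)
  zero_update : ∀ τ ∈ δ₀, τ.2.1 = 0 ∨ τ.2.1 = 1
  /-- positive transitions -/
  δpos : Set (Q × ℤ × Q)
  pos_update : ∀ τ ∈ δpos, τ.2.1 = -1 ∨ τ.2.1 = 0 ∨ τ.2.1 = 1

namespace OneCounterProcess

/-- A one-counter net is a one-counter process that cannot test its counter for zero. -/
def IsNet {P : Type} (O : OneCounterProcess P) : Prop := O.δ₀ ⊆ O.δpos

/-- The transition system of a one-counter process. -/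
def toTS {P : Type} (O : OneCounterProcess P) : TransitionSystem P where
  State := O.Q × ℕ
  label p := {s | s.1 ∈ O.label p}
  finite_label := O.finite_label.subset fun _ ⟨s, hs⟩ => ⟨s.1, hs⟩
  step s s' := (s.2 = 0 ∧ (s.1, (s'.2 : ℤ) - (s.2 : ℤ), s'.1) ∈ O.δ₀) ∨
    (0 < s.2 ∧ (s.1, (s'.2 : ℤ) - (s.2 : ℤ), s'.1) ∈ O.δpos)

/-- CTL model checking of the fixed process `O` in its fixed state `(q, n)`: the set of formulas
that hold there. -/
def modelChecking {P : Type} (O : OneCounterProcess P) (q : O.Q) (n : ℕ) : Set (CTL P) :=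
  {φ | (q, n) ∈ φ.sem O.toTS}

end OneCounterProcess

/-! ### The fixed one-counter net -/

/-- The control locations of the fixed net; they are also its atomic propositions. -/
inductive Loc where
  | t | tbar | q0 | q1 | q2 | q3 | f | g | p0 | p1
  deriving DecidableEq

instance Loc.instFintype : Fintype Loc where
  elems := {Loc.t, Loc.tbar, Loc.q0, Loc.q1, Loc.q2, Loc.q3, Loc.f, Loc.g, Loc.p0, Loc.p1}
  complete x := by cases x <;> decide

open Loc in
/-- The fixed net; each proposition holds exactly in the control location of the same name. -/
def fixedNet : OneCounterProcess Loc where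
  Q := Loc
  label p := {p}
  finite_label := Set.toFinite _
  δ₀ := {(t, 0, q0), (t, 0, f), (tbar, 1, p1), (tbar, 0, p0), (p0, 0, tbar)}
  zero_update := by simp
  δpos := {
    (q0, -1, q1), (q1, -1, q2), (q2, -1, q3), (q3, -1, q0), (q1, -1, q1), (q3, -1, q3),
    (q0, 0, t), (t, 0, q0), (q2, 0, t),
    (q1, 0, tbar), (tbar, 0, q1), (tbar, 0, q2), (q3, 0, tbar), (tbar, 0, q3),
    (t, 0, f), (tbar, -1, f), (f, -1, g), (g, -1, f),
    (tbar, 1, p1), (p1, 1, p1), (p1, 0, tbar), (tbar, 0, p0), (p0, 0, tbar)}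
  pos_update := by simp

/-! ### Polynomial space and PSPACE-hardness

The machines are Mathlib's deterministic multi-stack Turing machines. -/

/-- The space that a configuration occupies: the total length of the stacks. -/
def cfgSpace (tm : Turing.FinTM2) (c : tm.Cfg) : ℕ :=
  letI := tm.kFin
  ∑ k, (Turing.TM2.Cfg.stk c k).length

/-- A language belongs to PSPACE if its characteristic function is computed by a machine that, on
every input `x`, only runs through configurations of space polynomial in the length of `x`. -/
def InPSPACE (L : Set (List Bool)) : Prop :=
  ∃ (χ : List Bool → Bool) (M : Turing.TM2Computable id Computability.encodeBool χ)
    (p : Polynomial ℕ),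
    (∀ x, χ x = true ↔ x ∈ L) ∧
    ∀ (x : List Bool) (c : M.tm.Cfg),
      StateTransition.Reaches M.tm.step (Turing.initList M.tm (x.map M.inputAlphabet.invFun)) c →
        cfgSpace M.tm c ≤ p.eval x.length

/-- A problem `B`, whose instances are written down as words by `enc`, is PSPACE-hard if every
language in PSPACE has a polynomial-time many-one reduction to it. -/
def PSPACEHard {β Γ : Type} (enc : β → List Γ) (B : Set β) : Prop :=
  ∀ L : Set (List Bool), InPSPACE L →
    ∃ r : List Bool → β, Nonempty (Turing.TM2ComputableInPolyTime id enc r) ∧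
      ∀ x, x ∈ L ↔ r x ∈ B

/-! The counter is used as a bit string, and CTL over the fixed net evaluates quantified Boolean
formulas about its bits.

The locations `q0`, `q1`, `q2`, `q3`, `f`, `g` are deadlocked at counter value 0, so `¬∃X true`
replaces the zero test that a net lacks. Divisibility by powers of two is defined recursively
(`sat_psi`). Parity is an alternation of `f` and `g`. If divisibility by `D` can be tested in `t`
and its failure in `t̄`, then a descending run through the `q`-locations that is tested at every
state and ends in `(q0, 0)` has no freedom: at counter value `n` its location is `phase D n`
(`sat_walk`). This location determines divisibility by `2 * D` as well as a single bit (`sat_bitF`),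
and each level of the recursion adds only a constant number of symbols. A bit is quantified by
either keeping the counter (via `p0`) or climbing to the next multiple of the power of two (via
`p1`); see `sat_exQ`. Quantifying from the highest bit downwards, starting at counter 0, never
causes a carry.

A polynomial-space machine is turned into a local automaton on polynomially many cells
(`InPSPACE.exists_localStep`). Halting rows are fixed, so acceptance means that `2 ^ k` steps, with
`k` polynomial, lead from the initial row to the accepting one. This is expressed by Savitch's
bisection (`game_iff`): existential bits guess the middle row and one universal bit selects a half.
All choices remain stored in the counter, so the one-step relation occurs only once, applied to the
pair of rows that the universal bits select. The formula therefore has polynomial size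
(`sat_reachF`).

In prefix notation this formula is built from words by concatenation and by loops of computed
length. The classes `Evaluable` and `Writable` are closed under the operations needed, and their
programs are compiled to stack machines with exact step counts (`Exec.machine`), which gives the
polynomial-time reduction. -/

/-! ### Semantics of CTL over the fixed net -/

namespace CTL

/-- Disjunction. -/
def disj {P : Type} (φ ψ : CTL P) : CTL P := neg (conj (neg φ) (neg ψ))

theorem mem_sem_disj {P : Type} {T : TransitionSystem P} {φ ψ : CTL P} {s : T.State} :
    s ∈ (disj φ ψ).sem T ↔ s ∈ φ.sem T ∨ s ∈ ψ.sem T := by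
  simp only [disj, sem, Set.mem_compl_iff, Set.mem_inter_iff]; tauto

/-- The fixpoint unfolding of `∃ φ U ψ`. -/
theorem mem_sem_exU_iff {P : Type} {T : TransitionSystem P} {φ ψ : CTL P} {s : T.State} :
    s ∈ (exU φ ψ).sem T ↔
      s ∈ ψ.sem T ∨ (s ∈ φ.sem T ∧ ∃ s', T.step s s' ∧ s' ∈ (exU φ ψ).sem T) := by
  constructor
  · rintro ⟨k, π, h0, hs, hk, hφ⟩
    cases k with
    | zero => left; rwa [h0] at hk
    | succ k =>
      refine Or.inr ⟨h0 ▸ hφ 0 (Nat.succ_pos _), π 1, h0 ▸ hs 0 (Nat.succ_pos _), k,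
        fun i => π (i + 1), rfl, fun i hi => hs (i + 1) (by omega), hk,
        fun i hi => hφ (i + 1) (by omega)⟩
  · rintro (h | ⟨hφ, s', hs, k, π, h0, hst, hk, hφ'⟩)
    · exact ⟨0, fun _ => s, rfl, by simp, h, by simp⟩
    · refine ⟨k + 1, fun i => Nat.casesOn i s π, rfl, ?_, hk, ?_⟩
      · intro i hi
        cases i with
        | zero => simpa [h0] using hs
        | succ i => exact hst i (by omega)
      · intro i hi
        cases i with
        | zero => exact hφ
        | succ i => exact hφ' i (by omega)

/-- `Sat φ q n` says that `φ` holds in the state `(q, n)` of the fixed net. -/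
def Sat (φ : CTL Loc) (q : Loc) (n : ℕ) : Prop := (q, n) ∈ φ.sem fixedNet.toTS

/-- The transition relation of the fixed net. -/
def Step (q : Loc) (n : ℕ) (q' : Loc) (n' : ℕ) : Prop := fixedNet.toTS.step (q, n) (q', n')

open Loc

theorem step_t {n q' m} : Step t n q' m ↔ m = n ∧ (q' = q0 ∨ q' = f) := by
  simp [Step, fixedNet, OneCounterProcess.toTS]; grind
theorem step_tbar {n q' m} : Step tbar n q' m ↔
    (m = n + 1 ∧ q' = p1) ∨ (m = n ∧ q' = p0) ∨
      (0 < n ∧ m = n ∧ (q' = q1 ∨ q' = q2 ∨ q' = q3)) ∨ (n = m + 1 ∧ q' = f) := by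
  simp [Step, fixedNet, OneCounterProcess.toTS]; grind
theorem step_q0 {n q' m} : Step q0 n q' m ↔
    0 < n ∧ ((n = m + 1 ∧ q' = q1) ∨ (n = m ∧ q' = t)) := by
  simp [Step, fixedNet, OneCounterProcess.toTS]; grind
theorem step_q1 {n q' m} : Step q1 n q' m ↔
    0 < n ∧ ((n = m + 1 ∧ (q' = q1 ∨ q' = q2)) ∨ (n = m ∧ q' = tbar)) := by
  simp [Step, fixedNet, OneCounterProcess.toTS]; grind
theorem step_q2 {n q' m} : Step q2 n q' m ↔
    0 < n ∧ ((n = m + 1 ∧ q' = q3) ∨ (n = m ∧ q' = t)) := by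
  simp [Step, fixedNet, OneCounterProcess.toTS]; grind
theorem step_q3 {n q' m} : Step q3 n q' m ↔
    0 < n ∧ ((n = m + 1 ∧ (q' = q3 ∨ q' = q0)) ∨ (n = m ∧ q' = tbar)) := by
  simp [Step, fixedNet, OneCounterProcess.toTS]; grind
theorem step_f {n q' m} : Step f n q' m ↔ n = m + 1 ∧ q' = g := by
  simp [Step, fixedNet, OneCounterProcess.toTS]; grind
theorem step_g {n q' m} : Step g n q' m ↔ n = m + 1 ∧ q' = f := by
  simp [Step, fixedNet, OneCounterProcess.toTS]; grind
theorem step_p0 {n q' m} : Step p0 n q' m ↔ m = n ∧ q' = tbar := by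
  simp [Step, fixedNet, OneCounterProcess.toTS]; grind
theorem step_p1 {n q' m} : Step p1 n q' m ↔
    0 < n ∧ ((m = n + 1 ∧ q' = p1) ∨ (m = n ∧ q' = tbar)) := by
  simp [Step, fixedNet, OneCounterProcess.toTS]; grind

theorem exists_step_t {n} {R : Loc → ℕ → Prop} :
    (∃ q' m, Step t n q' m ∧ R q' m) ↔ R q0 n ∨ R f n := by
  simp only [step_t]; grind
theorem exists_step_tbar {n} {R : Loc → ℕ → Prop} :
    (∃ q' m, Step tbar n q' m ∧ R q' m) ↔
      R p1 (n + 1) ∨ R p0 n ∨ (0 < n ∧ (R q1 n ∨ R q2 n ∨ R q3 n ∨ R f (n - 1))) := by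
  simp only [step_tbar]
  constructor
  · rintro ⟨q', m, h, hR⟩
    rcases h with ⟨rfl, rfl⟩ | ⟨rfl, rfl⟩ | ⟨h, rfl, rfl | rfl | rfl⟩ | ⟨rfl, rfl⟩ <;> simp_all
  · rintro (h | h | ⟨h0, h | h | h | h⟩)
    · exact ⟨p1, n + 1, by simp, h⟩
    · exact ⟨p0, n, by simp, h⟩
    · exact ⟨q1, n, by simp [h0], h⟩
    · exact ⟨q2, n, by simp [h0], h⟩
    · exact ⟨q3, n, by simp [h0], h⟩
    · exact ⟨f, n - 1, by simp; omega, h⟩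
theorem exists_step_q0 {n} {R : Loc → ℕ → Prop} :
    (∃ q' m, Step q0 n q' m ∧ R q' m) ↔ 0 < n ∧ (R q1 (n - 1) ∨ R t n) := by
  simp only [step_q0]
  constructor
  · rintro ⟨q', m, ⟨h0, ⟨rfl, rfl⟩ | ⟨rfl, rfl⟩⟩, hR⟩ <;> simp_all
  · rintro ⟨h0, h | h⟩
    · exact ⟨q1, n - 1, ⟨h0, Or.inl ⟨by omega, rfl⟩⟩, h⟩
    · exact ⟨t, n, by simp [h0], h⟩
theorem exists_step_q1 {n} {R : Loc → ℕ → Prop} :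
    (∃ q' m, Step q1 n q' m ∧ R q' m) ↔ 0 < n ∧ (R q1 (n - 1) ∨ R q2 (n - 1) ∨ R tbar n) := by
  simp only [step_q1]
  constructor
  · rintro ⟨q', m, ⟨h0, ⟨rfl, rfl | rfl⟩ | ⟨rfl, rfl⟩⟩, hR⟩ <;> simp_all
  · rintro ⟨h0, h | h | h⟩
    · exact ⟨q1, n - 1, ⟨h0, Or.inl ⟨by omega, by simp⟩⟩, h⟩
    · exact ⟨q2, n - 1, ⟨h0, Or.inl ⟨by omega, by simp⟩⟩, h⟩
    · exact ⟨tbar, n, by simp [h0], h⟩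
theorem exists_step_q2 {n} {R : Loc → ℕ → Prop} :
    (∃ q' m, Step q2 n q' m ∧ R q' m) ↔ 0 < n ∧ (R q3 (n - 1) ∨ R t n) := by
  simp only [step_q2]
  constructor
  · rintro ⟨q', m, ⟨h0, ⟨rfl, rfl⟩ | ⟨rfl, rfl⟩⟩, hR⟩ <;> simp_all
  · rintro ⟨h0, h | h⟩
    · exact ⟨q3, n - 1, ⟨h0, Or.inl ⟨by omega, rfl⟩⟩, h⟩
    · exact ⟨t, n, by simp [h0], h⟩
theorem exists_step_q3 {n} {R : Loc → ℕ → Prop} :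
    (∃ q' m, Step q3 n q' m ∧ R q' m) ↔ 0 < n ∧ (R q3 (n - 1) ∨ R q0 (n - 1) ∨ R tbar n) := by
  simp only [step_q3]
  constructor
  · rintro ⟨q', m, ⟨h0, ⟨rfl, rfl | rfl⟩ | ⟨rfl, rfl⟩⟩, hR⟩ <;> simp_all
  · rintro ⟨h0, h | h | h⟩
    · exact ⟨q3, n - 1, ⟨h0, Or.inl ⟨by omega, by simp⟩⟩, h⟩
    · exact ⟨q0, n - 1, ⟨h0, Or.inl ⟨by omega, by simp⟩⟩, h⟩
    · exact ⟨tbar, n, by simp [h0], h⟩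
theorem exists_step_p1 {n} {R : Loc → ℕ → Prop} :
    (∃ q' m, Step p1 n q' m ∧ R q' m) ↔ 0 < n ∧ (R p1 (n + 1) ∨ R tbar n) := by
  simp only [step_p1]; grind

theorem sat_atom {p q : Loc} {n : ℕ} : Sat (atom p) q n ↔ q = p := Iff.rfl
theorem sat_neg {φ q n} : Sat (neg φ) q n ↔ ¬ Sat φ q n := Iff.rfl
theorem sat_conj {φ ψ q n} : Sat (conj φ ψ) q n ↔ Sat φ q n ∧ Sat ψ q n := Iff.rfl
theorem sat_disj {φ ψ q n} : Sat (disj φ ψ) q n ↔ Sat φ q n ∨ Sat ψ q n := mem_sem_disj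
theorem sat_exX {φ q n} : Sat (exX φ) q n ↔ ∃ q' m, Step q n q' m ∧ Sat φ q' m :=
  ⟨fun ⟨s, hs, h⟩ => ⟨s.1, s.2, h, hs⟩, fun ⟨q', m, h, hs⟩ => ⟨(q', m), hs, h⟩⟩
theorem sat_exU {φ ψ q n} : Sat (exU φ ψ) q n ↔
    Sat ψ q n ∨ (Sat φ q n ∧ ∃ q' m, Step q n q' m ∧ Sat (exU φ ψ) q' m) := by
  refine mem_sem_exU_iff.trans (or_congr_right (and_congr_right fun _ => ?_))
  exact ⟨fun ⟨s, hs, h⟩ => ⟨s.1, s.2, hs, h⟩, fun ⟨q', m, h, hs⟩ => ⟨(q', m), h, hs⟩⟩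

/-- A tautology. -/
def tru : CTL Loc := neg (conj (atom t) (neg (atom t)))

theorem sat_tru {q n} : Sat tru q n := by simp [tru, sat_neg, sat_conj]

/-- A formula with a fixed truth value. -/
def ofBool (b : Bool) : CTL Loc := cond b tru (neg tru)

theorem sat_ofBool {b q n} : Sat (ofBool b) q n ↔ b = true := by
  cases b <;> simp [ofBool, sat_neg, sat_tru]

/-! ### Divisibility by powers of two -/

/-- The run along `q₀, q₁, q₂, q₃` that ends in `(q₀, 0)` and on which `ψ` confirms, in the
locations `t` and `t̄`, that every location matches the value of the counter. -/
def walk (ψ : CTL Loc) : CTL Loc :=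
  exU (conj (disj (disj (atom q0) (atom q1)) (disj (atom q2) (atom q3)))
      (exX (conj (disj (atom t) (atom tbar)) ψ)))
    (conj (atom q0) (neg (exX tru)))

/-- `psi j` states in location `t` that the counter is divisible by `2 ^ (j + 1)`, and in location
`t̄` that it is not. -/
def psi : ℕ → CTL Loc
  | 0 => exX (exU (disj (atom f) (atom g)) (conj (atom f) (neg (exX tru))))
  | j + 1 => exX (walk (psi j))

/-- Each step between `f` and `g` lowers the counter by one, and both are deadlocked exactly at 0.
The run is forced, and it ends in `f` according to the parity of `n`. -/
theorem sat_parity {q n} :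
    Sat (exU (disj (atom f) (atom g)) (conj (atom f) (neg (exX tru)))) q n ↔
      (q = f ∧ Even n) ∨ (q = g ∧ ¬ Even n) := by
  induction n generalizing q with
  | zero =>
    rw [sat_exU]
    simp only [sat_disj, sat_conj, sat_atom, sat_neg, sat_exX, sat_tru]
    cases q <;> simp [step_f, step_g]
  | succ n ih =>
    rw [sat_exU]
    simp only [sat_disj, sat_conj, sat_atom, sat_neg, sat_exX, sat_tru]
    cases q <;> simp [step_f, step_g, ih, Nat.even_add_one]

/-- The location that matches the counter value `n` on a run counting multiples of `D`. -/
def phase (D n : ℕ) : Loc :=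
  if n % (2 * D) = 0 then q0 else if D < n % (2 * D) then q1
  else if n % (2 * D) = D then q2 else q3

theorem phase_cases (D n : ℕ) :
    phase D n = q0 ∨ phase D n = q1 ∨ phase D n = q2 ∨ phase D n = q3 := by
  unfold phase; split_ifs <;> simp

theorem phase_zero (D : ℕ) : phase D 0 = q0 := by simp [phase]

/-- Seen from the phase at `n`, the correct location at `n + 1` is singled out by two local
conditions: the parity of its index must agree with divisibility by `D`, and there must be an edge
to the phase at `n`. For `D = 1` the locations `q1` and `q3` would have to be skipped, which the
edges do not allow. -/
theorem phase_step_iff {D n : ℕ} (hD : 2 ≤ D) (q : Loc) :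
    q = phase D (n + 1) ↔
      (((q = q0 ∨ q = q2) ∧ D ∣ n + 1) ∨ ((q = q1 ∨ q = q3) ∧ ¬ D ∣ n + 1)) ∧
        Step q (n + 1) (phase D n) n := by
  -- The multiples of `D` are the residues 0 and `D` modulo `2 * D`, matching `q0` and `q2`.
  have hdvd : D ∣ n + 1 ↔ (n + 1) % (2 * D) = 0 ∨ (n + 1) % (2 * D) = D := by
    constructor
    · rintro ⟨c, hc⟩
      rw [hc, mul_comm 2 D, Nat.mul_mod_mul_left]
      rcases Nat.mod_two_eq_zero_or_one c with h | h <;> simp [h]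
    · intro h
      have h1 := Nat.div_add_mod (n + 1) (2 * D)
      rcases h with h | h
      · exact ⟨2 * ((n + 1) / (2 * D)), by rw [h] at h1; rw [← mul_assoc]; linarith⟩
      · exact ⟨2 * ((n + 1) / (2 * D)) + 1, by rw [h] at h1; nlinarith⟩
  have hlt : (n + 1) % (2 * D) < 2 * D := Nat.mod_lt _ (by omega)
  have hlt' : n % (2 * D) < 2 * D := Nat.mod_lt _ (by omega)
  -- With both residues generalized, this relation leaves a finite case analysis over the locations.
  have hmod : (n + 1) % (2 * D) = if n % (2 * D) + 1 = 2 * D then 0 else n % (2 * D) + 1 := by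
    rw [Nat.add_mod, Nat.mod_eq_of_lt (show 1 < 2 * D by omega)]
    split_ifs with h
    · rw [h, Nat.mod_self]
    · rw [Nat.mod_eq_of_lt (by omega)]
  rw [hdvd]
  unfold phase
  generalize (n + 1) % (2 * D) = r at *
  generalize n % (2 * D) = r' at *
  split_ifs at hmod ⊢ <;> cases q <;> simp [step_q0, step_q1, step_q2, step_q3] <;> omega

/-- Induction upwards from the forced end `(q0, 0)`. The side edge leads from `q0`, `q2` to `t` and
from `q1`, `q3` to `t̄`, where `ψ` tests for multiples and for non-multiples of `D`, respectively;
this is the local condition of `phase_step_iff`. -/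
theorem sat_walk {ψ : CTL Loc} {D : ℕ} (hD : 2 ≤ D) (ht : ∀ n, Sat ψ t n ↔ D ∣ n)
    (htbar : ∀ n, Sat ψ tbar n ↔ ¬ D ∣ n) (q : Loc) (n : ℕ) :
    Sat (walk ψ) q n ↔ q = phase D n := by
  induction n generalizing q with
  | zero =>
    rw [walk, sat_exU, ← walk]
    simp only [sat_disj, sat_conj, sat_atom, sat_neg, sat_exX, sat_tru]
    cases q <;> simp [step_q0, step_q1, step_q2, step_q3, phase]
  | succ n ih =>
    -- The run cannot use the side edges itself, since neither argument of the until holds in `t` or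
    -- `t̄`.
    have hnw : ∀ m, ¬ Sat (walk ψ) t m ∧ ¬ Sat (walk ψ) tbar m := by
      intro m
      rw [walk, sat_exU, sat_exU]
      simp [sat_disj, sat_conj, sat_atom]
    rw [phase_step_iff hD, walk, sat_exU, ← walk]
    simp only [sat_disj, sat_conj, sat_atom, sat_neg, sat_exX, sat_tru]
    have hph := phase_cases D n
    cases q <;> try simp only [exists_step_q0, exists_step_q1, exists_step_q2, exists_step_q3]
    all_goals simp [ht, htbar, hnw, ih, step_q0, step_q1, step_q2, step_q3]
    all_goals grind

theorem phase_eq_q0_iff {D n : ℕ} : phase D n = q0 ↔ 2 * D ∣ n := by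
  rw [phase, Nat.dvd_iff_mod_eq_zero]; split_ifs <;> simp_all

/-- Among the successors of `t` only `q0` can match a phase, and `t̄` has edges to the three other
phases, so one formula yields a condition and its negation. At counter 0 the location `t̄` has no
edge to `q1`, `q2`, `q3` or `f`, in accordance with 0 being divisible by everything. -/
theorem sat_psi (j : ℕ) : (∀ n, Sat (psi j) t n ↔ 2 ^ (j + 1) ∣ n) ∧
    ∀ n, Sat (psi j) tbar n ↔ ¬ 2 ^ (j + 1) ∣ n := by
  induction j with
  | zero =>
    constructor <;> intro n <;> simp only [psi, sat_exX, sat_parity, zero_add, pow_one,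
      ← even_iff_two_dvd]
    · simp [exists_step_t]
    · cases n <;> simp [exists_step_tbar, Nat.even_add_one]
  | succ j ih =>
    have hD : 2 ≤ 2 ^ (j + 1) := by rw [pow_succ]; have := Nat.one_le_two_pow (n := j); omega
    have hpow : 2 ^ (j + 1 + 1) = 2 * 2 ^ (j + 1) := by ring
    constructor <;> intro n <;>
      simp only [psi, sat_exX, sat_walk hD ih.1 ih.2, hpow, ← phase_eq_q0_iff]
    · have := phase_cases (2 ^ (j + 1)) n
      rw [exists_step_t]; grind
    · have := phase_cases (2 ^ (j + 1)) n
      have := phase_cases (2 ^ (j + 1)) (n + 1)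
      have := phase_cases (2 ^ (j + 1)) (n - 1)
      have := phase_zero (2 ^ (j + 1))
      rw [exists_step_tbar]; grind

/-- `walk` for the modulus `2 ^ (j + 1)`. -/
theorem sat_walk_psi (j : ℕ) (q : Loc) (n : ℕ) :
    Sat (walk (psi j)) q n ↔ q = phase (2 ^ (j + 1)) n := by
  refine sat_walk ?_ (sat_psi j).1 (sat_psi j).2 q n
  rw [pow_succ]; have := Nat.one_le_two_pow (n := j); omega

/-- In location `t̄`, `bitF j` states that bit `j + 1` of the counter is set. -/
def bitF (j : ℕ) : CTL Loc := exX (conj (disj (atom q1) (atom q2)) (walk (psi j)))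

/-- The phases `q1` and `q2` are those in which the residue modulo `2 * 2 ^ (j + 1)` is at least `2
^ (j + 1)`, that is, in which the leading bit of the residue is set. -/
theorem sat_bitF (j n : ℕ) : Sat (bitF j) tbar n ↔ n.testBit (j + 1) = true := by
  simp only [bitF, sat_exX, sat_conj, sat_disj, sat_atom, sat_walk_psi]
  have hD : 0 < 2 ^ (j + 1) := by positivity
  have h1 : n.testBit (j + 1) = true ↔ 2 ^ (j + 1) ≤ n % (2 * 2 ^ (j + 1)) := by
    rw [Nat.testBit_eq_decide_div_mod_eq, decide_eq_true_iff, mul_comm 2, ← Nat.mod_mul_right_div_self,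
      Nat.div_eq_iff hD]
    have := Nat.mod_lt n (show 0 < 2 ^ (j + 1) * 2 by positivity)
    omega
  rw [h1]
  rcases Nat.eq_zero_or_pos n with rfl | h
  · rw [exists_step_tbar]; simp
  · have hlt := Nat.mod_lt n (show 0 < 2 * 2 ^ (j + 1) by positivity)
    rw [exists_step_tbar]
    simp only [h, true_and, reduceCtorEq, or_self, or_false, false_or, or_true, false_and]
    unfold phase
    generalize n % (2 * 2 ^ (j + 1)) = r at *
    generalize 2 ^ (j + 1) = D at *
    split_ifs <;> simp <;> omega

/-! ### Quantification over bits of the counter -/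

/-- Existential quantification over bit `j + 1` of the counter. -/
def exQ (j : ℕ) (θ : CTL Loc) : CTL Loc :=
  exX (exU (conj (atom p1) (exX (conj (atom tbar) (psi j))))
    (conj (disj (atom p0) (conj (atom p1) (exX (conj (atom tbar) (neg (psi j))))))
      (exX (conj (atom tbar) θ))))

/-- The branch through `p0` returns with the same counter. The branch through `p1` starts at `n +
1`; there the left argument of the until holds only at non-multiples of `2 ^ (j + 1)` and the right
one only at multiples, so the climb must stop exactly at `n + 2 ^ (j + 1)`. -/
theorem sat_exQ {j n : ℕ} (hn : 2 ^ (j + 1) ∣ n) (θ : CTL Loc) :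
    Sat (exQ j θ) tbar n ↔ Sat θ tbar n ∨ Sat θ tbar (n + 2 ^ (j + 1)) := by
  set φ := conj (atom p1) (exX (conj (atom tbar) (psi j))) with hφ
  set χ := conj (disj (atom p0) (conj (atom p1) (exX (conj (atom tbar) (neg (psi j))))))
      (exX (conj (atom tbar) θ)) with hχ
  -- The until run stays in `p0` and `p1`; its excursions to `t̄` occur only inside `∃X`.
  have hloc : ∀ q m, q ≠ p0 → q ≠ p1 → ¬ Sat (exU φ χ) q m := by
    intro q m h0 h1
    rw [sat_exU]
    simp [hφ, hχ, sat_conj, sat_disj, sat_atom, h0, h1]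
  have h0 : ∀ m, Sat (exU φ χ) p0 m ↔ Sat θ tbar m := by
    intro m
    rw [sat_exU]
    simp [hφ, hχ, sat_conj, sat_disj, sat_atom, sat_exX, step_p0]
  have h1 : ∀ m, 0 < m → (Sat (exU φ χ) p1 m ↔
      if 2 ^ (j + 1) ∣ m then Sat θ tbar m else Sat (exU φ χ) p1 (m + 1)) := by
    intro m hm
    rw [sat_exU]
    have e1 : Sat φ p1 m ↔ ¬ 2 ^ (j + 1) ∣ m := by
      simp [hφ, sat_conj, sat_atom, sat_exX, exists_step_p1, hm, (sat_psi j).2]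
    have e2 : Sat χ p1 m ↔ 2 ^ (j + 1) ∣ m ∧ Sat θ tbar m := by
      simp [hχ, sat_conj, sat_disj, sat_neg, sat_atom, sat_exX, exists_step_p1, hm, (sat_psi j).2]
    rw [exists_step_p1, e1, e2]
    have := hloc tbar m
    grind
  -- Induction on the distance `i` to the next multiple; `i = 2 ^ (j + 1) - 1` is the entry point `n
  -- + 1`.
  have hrun : ∀ i, i < 2 ^ (j + 1) →
      (Sat (exU φ χ) p1 (n + 2 ^ (j + 1) - i) ↔ Sat θ tbar (n + 2 ^ (j + 1))) := by
    intro i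
    induction i with
    | zero =>
      intro _
      rw [Nat.sub_zero, h1 _ (by positivity), if_pos (by simpa using hn)]
    | succ i ih =>
      intro hi
      have hnd : ¬ 2 ^ (j + 1) ∣ n + 2 ^ (j + 1) - (i + 1) := by
        intro hd
        have : 2 ^ (j + 1) ∣ i + 1 := by
          have h2 := Nat.dvd_sub (Dvd.dvd.add hn (dvd_refl (2 ^ (j + 1)))) hd
          rwa [Nat.sub_sub_self (by omega)] at h2
        exact absurd (Nat.le_of_dvd (by omega) this) (by omega)
      rw [h1 _ (by omega), if_neg hnd, ← ih (by omega)]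
      rw [show n + 2 ^ (j + 1) - (i + 1) + 1 = n + 2 ^ (j + 1) - i by omega]
  have hone := hrun (2 ^ (j + 1) - 1) (by have := Nat.one_le_two_pow (n := j + 1); omega)
  rw [show n + 2 ^ (j + 1) - (2 ^ (j + 1) - 1) = n + 1 by
    have := Nat.one_le_two_pow (n := j + 1); omega] at hone
  rw [exQ, sat_exX, ← hφ, ← hχ]
  rw [exists_step_tbar, ← h0, ← hone]
  have := hloc q1 n
  have := hloc q2 n
  have := hloc q3 n
  have := hloc f (n - 1)
  grind

/-- Universal quantification over bit `j + 1` of the counter. -/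
def allQ (j : ℕ) (θ : CTL Loc) : CTL Loc := neg (exQ j (neg θ))

theorem sat_allQ {j n : ℕ} (hn : 2 ^ (j + 1) ∣ n) (θ : CTL Loc) :
    Sat (allQ j θ) tbar n ↔ Sat θ tbar n ∧ Sat θ tbar (n + 2 ^ (j + 1)) := by
  rw [allQ, sat_neg, sat_exQ hn, sat_neg, sat_neg]; tauto

end CTL

/-! ### Quantifier blocks -/

namespace CTL

open Loc (tbar)

/-- The bits of the counter from position `1` on, as an assignment of truth values. -/
def bits (n : ℕ) : ℕ → Bool := fun j => n.testBit (j + 1)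

/-- In location `t̄`, for counter values divisible by `2 ^ (m + 1)`, the formula `θ` expresses the
property `P` of assignments. -/
def Expresses (m : ℕ) (θ : CTL Loc) (P : (ℕ → Bool) → Prop) : Prop :=
  ∀ n, 2 ^ (m + 1) ∣ n → (Sat θ tbar n ↔ P (bits n))

theorem bits_update_false {m n : ℕ} (hn : 2 ^ (m + 2) ∣ n) :
    Function.update (bits n) m false = bits n := by
  obtain ⟨q, rfl⟩ := hn
  rw [Function.update_eq_self_iff, bits]
  have := Nat.testBit_two_pow_mul_add q (show 0 < 2 ^ (m + 2) by positivity) (m + 1)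
  simp_all

/-- Divisibility by `2 ^ (m + 2)` makes bit `m + 1` of the counter zero, so the addition sets it
without a carry. The index shifts by one because `bits` skips bit 0. -/
theorem bits_add_two_pow {m n : ℕ} (hn : 2 ^ (m + 2) ∣ n) :
    bits (n + 2 ^ (m + 1)) = Function.update (bits n) m true := by
  obtain ⟨q, rfl⟩ := hn
  funext j
  have h1 := Nat.testBit_two_pow_mul_add q
    (show 2 ^ (m + 1) < 2 ^ (m + 2) from Nat.pow_lt_pow_right (by norm_num) (by omega)) (j + 1)
  have h2 := Nat.testBit_two_pow_mul_add q (show 0 < 2 ^ (m + 2) by positivity) (j + 1)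
  rw [add_zero] at h2
  rw [Function.update_apply, bits, bits, h1, h2, Nat.testBit_two_pow]
  split_ifs <;> grind

theorem Expresses.exQ {m : ℕ} {θ : CTL Loc} {P : (ℕ → Bool) → Prop} (h : Expresses m θ P) :
    Expresses (m + 1) (exQ m θ) fun ν => ∃ b, P (Function.update ν m b) := by
  intro n hn
  have hn' : 2 ^ (m + 1) ∣ n := (pow_dvd_pow 2 (by omega)).trans hn
  rw [sat_exQ hn', h n hn', h _ (Dvd.dvd.add hn' (dvd_refl _)), bits_add_two_pow hn,
    ← bits_update_false hn]
  simp only [Bool.exists_bool, Function.update_idem]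

theorem Expresses.allQ {m : ℕ} {θ : CTL Loc} {P : (ℕ → Bool) → Prop} (h : Expresses m θ P) :
    Expresses (m + 1) (allQ m θ) fun ν => ∀ b, P (Function.update ν m b) := by
  intro n hn
  have hn' : 2 ^ (m + 1) ∣ n := (pow_dvd_pow 2 (by omega)).trans hn
  rw [sat_allQ hn', h n hn', h _ (Dvd.dvd.add hn' (dvd_refl _)), bits_add_two_pow hn,
    ← bits_update_false hn]
  simp only [Bool.forall_bool, Function.update_idem]

/-- Existential quantification over `t` consecutive bits. -/
def exBlock (m : ℕ) : ℕ → CTL Loc → CTL Loc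
  | 0, θ => θ
  | t + 1, θ => exQ (m + t) (exBlock m t θ)

/-- The assignment `ν`, overwritten by `u` at the `t` positions from `m` on. -/
def overwrite (ν u : ℕ → Bool) (m t : ℕ) : ℕ → Bool :=
  fun i => if m ≤ i ∧ i < m + t then u i else ν i

theorem Expresses.exBlock {m : ℕ} {θ : CTL Loc} {P : (ℕ → Bool) → Prop} (h : Expresses m θ P)
    (t : ℕ) : Expresses (m + t) (exBlock m t θ) fun ν => ∃ u, P (overwrite ν u m t) := by
  induction t with
  | zero =>
    intro n hn
    have : ∀ u, overwrite (bits n) u m 0 = bits n := by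
      intro u; funext i; rw [overwrite, if_neg (by omega)]
    simp only [this, exists_const]
    exact h n hn
  | succ t ih =>
    intro n hn
    refine (ih.exQ n hn).trans ?_
    -- The outermost quantifier sets the highest bit of the block; the inner ones leave it alone.
    have key : ∀ b (u : ℕ → Bool), overwrite (Function.update (bits n) (m + t) b) u m t =
        overwrite (bits n) (Function.update u (m + t) b) m (t + 1) := by
      intro b u
      funext i
      simp only [overwrite, Function.update_apply]
      split_ifs <;> first | rfl | omega
    constructor
    · rintro ⟨b, u, hu⟩
      exact ⟨_, key b u ▸ hu⟩
    · rintro ⟨u, hu⟩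
      refine ⟨u (m + t), u, ?_⟩
      rw [key, Function.update_eq_self]
      exact hu

/-! ### Boolean combinations -/

/-- If-then-else. -/
def ite (c φ ψ : CTL Loc) : CTL Loc := disj (conj c φ) (conj (neg c) ψ)

/-- Equivalence. -/
def iff (φ ψ : CTL Loc) : CTL Loc := conj (neg (conj φ (neg ψ))) (neg (conj (neg φ) ψ))

/-- The conjunction of a list of formulas. -/
def bigConj (l : List (CTL Loc)) : CTL Loc := l.foldr conj tru

/-- The disjunction of a list of formulas. -/
def bigDisj (l : List (CTL Loc)) : CTL Loc := l.foldr disj (neg tru)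

theorem sat_ite {c φ ψ q n} : Sat (ite c φ ψ) q n ↔
    (Sat c q n ∧ Sat φ q n) ∨ (¬ Sat c q n ∧ Sat ψ q n) := by
  simp [ite, sat_disj, sat_conj, sat_neg]

theorem sat_iff {φ ψ q n} : Sat (iff φ ψ) q n ↔ (Sat φ q n ↔ Sat ψ q n) := by
  simp only [iff, sat_conj, sat_neg]; tauto

theorem sat_bigConj {l : List (CTL Loc)} {q n} : Sat (bigConj l) q n ↔ ∀ φ ∈ l, Sat φ q n := by
  induction l with
  | nil => simp [bigConj, sat_tru]
  | cons φ l ih =>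
    rw [bigConj, List.foldr_cons, ← bigConj, sat_conj, ih, List.forall_mem_cons]

theorem sat_bigDisj {l : List (CTL Loc)} {q n} : Sat (bigDisj l) q n ↔ ∃ φ ∈ l, Sat φ q n := by
  induction l with
  | nil => simp [bigDisj, sat_tru, sat_neg]
  | cons φ l ih =>
    rw [bigDisj, List.foldr_cons, ← bigDisj, sat_disj, ih]; simp

end CTL

/-! ### Local automata

The cells `0, …, W` of a local automaton carry letters of a finite alphabet; in each step the new
letter of a cell is determined by the old letters of cell `0`, of the cell and of its neighbours. -/

/-- The cell to the left of a cell (cell `0` is its own left neighbour). -/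
def leftCell {W : ℕ} (i : Fin (W + 1)) : Fin (W + 1) := ⟨i - 1, by omega⟩

/-- The cell to the right of a cell (the last cell is its own right neighbour). -/
def rightCell {W : ℕ} (i : Fin (W + 1)) : Fin (W + 1) := ⟨min (i + 1) W, by omega⟩

/-- One step of the local automaton with the rule `f` on `W + 1` cells. -/
def localStep {A : Type} (f : A → A → A → A → A) (W : ℕ) (C : Fin (W + 1) → A) : Fin (W + 1) → A :=
  fun i => f (C 0) (C (leftCell i)) (C i) (C (rightCell i))

/-! ### Rows of letters as rows of bits. -/

section OneHot

variable {s : ℕ} (f : Fin s → Fin s → Fin s → Fin s → Fin s) {W : ℕ}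

/-- The quadruples of letters on which the rule `f` yields `d`. -/
noncomputable def preimages (d : Fin s) : List (Fin s × Fin s × Fin s × Fin s) :=
  (Finset.univ.filter fun x : Fin s × Fin s × Fin s × Fin s =>
    f x.1 x.2.1 x.2.2.1 x.2.2.2 = d).toList

theorem mem_preimages {d : Fin s} {x : Fin s × Fin s × Fin s × Fin s} :
    x ∈ preimages f d ↔ f x.1 x.2.1 x.2.2.1 x.2.2.2 = d := by
  simp [preimages]

/-- The one-hot encoding of a configuration. -/
def oneHot (C : Fin (W + 1) → Fin s) : Fin (W + 1) → Fin s → Bool := fun i a => C i = a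

theorem oneHot_injective : Function.Injective (oneHot (s := s) (W := W)) := by
  intro C C' h
  funext i
  have := congrFun (congrFun h i) (C i)
  simpa [oneHot, eq_comm] using this

/-- A step of the local automaton, performed on arbitrary sets of letters in the cells. -/
noncomputable def liftStep (u : Fin (W + 1) → Fin s → Bool) : Fin (W + 1) → Fin s → Bool := fun i d =>
  decide (∃ x ∈ preimages f d, u 0 x.1 = true ∧ u (leftCell i) x.2.1 = true ∧
    u i x.2.2.1 = true ∧ u (rightCell i) x.2.2.2 = true)

/-- On one-hot rows the four letters read are unique. As `liftStep` is a total function on all rows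
of bits, guessed rows need no test for being one-hot: the equations of the bisection determine them.
-/
theorem liftStep_oneHot (C : Fin (W + 1) → Fin s) :
    liftStep f (oneHot C) = oneHot (localStep f W C) := by
  funext i d
  rw [liftStep, oneHot, Bool.eq_iff_iff, decide_eq_true_iff, decide_eq_true_iff]
  simp only [oneHot, mem_preimages, localStep, decide_eq_true_iff]
  constructor
  · rintro ⟨x, rfl, h0, h1, h2, h3⟩
    rw [h0, h1, h2, h3]
  · intro h
    exact ⟨(_, _, _, _), h, rfl, rfl, rfl, rfl⟩

theorem liftStep_iterate_oneHot (C : Fin (W + 1) → Fin s) (n : ℕ) :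
    (liftStep f)^[n] (oneHot C) = oneHot ((localStep f W)^[n] C) :=
  (Function.Semiconj.iterate_right (f := oneHot) (fun C => (liftStep_oneHot f C).symm) n C).symm

end OneHot

/-! ### The reachability formula -/

namespace CTL

open Loc (tbar)

/-! ### Bisection as a game on assignments. -/

section Reach

variable (s W : ℕ)

/-- The number of bits that one level of the reachability formula occupies. -/
def levelSize : ℕ := (W + 1) * s + 1

/-- The position of the bit of level `j` that says that cell `i` carries the letter `a`. -/
def cellIdx (j i a : ℕ) : ℕ := j * levelSize s W + 1 + (i * s + a)

/-- The configuration that an assignment stores at level `j`. -/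
def midCfg (j : ℕ) (ν : ℕ → Bool) : Fin (W + 1) → Fin s → Bool :=
  fun i a => ν (cellIdx s W j i a)

/-- The first configuration of the pair that the universal bits of the levels in `l` select. -/
def selFst (ν : ℕ → Bool) (base : Fin (W + 1) → Fin s → Bool) (l : List ℕ) :
    Fin (W + 1) → Fin s → Bool :=
  l.foldr (fun j u => if ν (j * levelSize s W) then midCfg s W j ν else u) base

/-- The second configuration of the pair that the universal bits of the levels in `l` select. -/
def selSnd (ν : ℕ → Bool) (base : Fin (W + 1) → Fin s → Bool) (l : List ℕ) :
    Fin (W + 1) → Fin s → Bool :=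
  l.foldr (fun j u => if ν (j * levelSize s W) then u else midCfg s W j ν) base

/-- The game that bisects a computation: at each level a middle configuration is guessed and one
of the two halves is challenged. -/
def Game (P : (ℕ → Bool) → Prop) : ℕ → (ℕ → Bool) → Prop
  | 0 => P
  | j + 1 => fun ν => ∃ u, ∀ b, Game P j
      (Function.update (overwrite ν u (j * levelSize s W + 1) ((W + 1) * s)) (j * levelSize s W) b)

variable {s W}

/-- Only bits of the listed levels are read, so writing at a lower level does not disturb the pair
already selected. -/
theorem selFst_congr {ν ν' : ℕ → Bool} {base : Fin (W + 1) → Fin s → Bool} {l : List ℕ} {m : ℕ}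
    (hl : ∀ j ∈ l, m ≤ j * levelSize s W) (h : ∀ i, m ≤ i → ν i = ν' i) :
    selFst s W ν base l = selFst s W ν' base l := by
  induction l with
  | nil => rfl
  | cons j l ih =>
    simp only [selFst, List.foldr_cons] at ih ⊢
    have hj := hl j (by simp)
    rw [ih fun i hi => hl i (by simp [hi]), h _ hj]
    congr 1
    funext i a
    exact h _ (by simp only [cellIdx]; omega)

theorem selSnd_congr {ν ν' : ℕ → Bool} {base : Fin (W + 1) → Fin s → Bool} {l : List ℕ} {m : ℕ}
    (hl : ∀ j ∈ l, m ≤ j * levelSize s W) (h : ∀ i, m ≤ i → ν i = ν' i) :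
    selSnd s W ν base l = selSnd s W ν' base l := by
  induction l with
  | nil => rfl
  | cons j l ih =>
    simp only [selSnd, List.foldr_cons] at ih ⊢
    have hj := hl j (by simp)
    rw [ih fun i hi => hl i (by simp [hi]), h _ hj]
    congr 1
    funext i a
    exact h _ (by simp only [cellIdx]; omega)

theorem cellIdx_bounds (j : ℕ) (i : Fin (W + 1)) (a : Fin s) :
    j * levelSize s W + 1 ≤ cellIdx s W j i a ∧
      cellIdx s W j i a < j * levelSize s W + 1 + (W + 1) * s := by
  have h1 : (i : ℕ) * s + a < (W + 1) * s := by
    have : ((i : ℕ) + 1) * s ≤ (W + 1) * s := Nat.mul_le_mul_right _ (by omega)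
    have h := a.2
    rw [add_mul, one_mul] at this
    omega
  simp only [cellIdx]
  omega

/-- Every row can be stored at level `j`: the offsets `i * s + a` with `a < s` are pairwise distinct
by division with remainder, and the universal bit lies just below the block. -/
theorem exists_midCfg (j : ℕ) (v : Fin (W + 1) → Fin s → Bool) :
    ∃ u : ℕ → Bool, ∀ ν b, midCfg s W j (Function.update
      (overwrite ν u (j * levelSize s W + 1) ((W + 1) * s)) (j * levelSize s W) b) = v := by
  refine ⟨fun p => if h : ∃ x : Fin (W + 1) × Fin s, cellIdx s W j x.1 x.2 = p then
    v h.choose.1 h.choose.2 else false, fun ν b => ?_⟩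
  funext i a
  have hb := cellIdx_bounds (s := s) (W := W) j i a
  rw [midCfg, Function.update_of_ne (by omega), overwrite, if_pos hb]
  have h : ∃ x : Fin (W + 1) × Fin s, cellIdx s W j x.1 x.2 = cellIdx s W j i a := ⟨(i, a), rfl⟩
  rw [dif_pos h]
  have hspec := h.choose_spec
  have hs : 0 < s := lt_of_le_of_lt (Nat.zero_le _) a.2
  have hinj : ∀ (i' : Fin (W + 1)) (a' : Fin s), cellIdx s W j i' a' = cellIdx s W j i a →
      i' = i ∧ a' = a := by
    intro i' a' he
    have he' : (a' : ℕ) + s * i' = a + s * i := by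
      simp only [cellIdx] at he; rw [mul_comm s, mul_comm s]; omega
    have h1 := congrArg (· / s) he'
    have h2 := congrArg (· % s) he'
    simp only [Nat.add_mul_div_left _ _ hs, Nat.div_eq_of_lt a'.2, Nat.div_eq_of_lt a.2,
      Nat.add_mul_mod_self_left, Nat.mod_eq_of_lt a'.2, Nat.mod_eq_of_lt a.2] at h1 h2
    exact ⟨Fin.ext (by omega), Fin.ext h2⟩
  have := hinj _ _ hspec
  rw [this.1, this.2]

/-- With the levels from `j` on already played, the remaining game decides whether `2 ^ j` steps
lead from the first selected row to the second. Since `G` is a function, a middle row that satisfies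
both halves exists exactly when the doubled iterate does the job. At `j = k` no level has been
played and the base rows remain. -/
theorem game_iff {G : (Fin (W + 1) → Fin s → Bool) → Fin (W + 1) → Fin s → Bool}
    {b₀ b₁ : Fin (W + 1) → Fin s → Bool} {k : ℕ} (j r : ℕ) (hk : j + r = k) (ν : ℕ → Bool) :
    Game s W (fun ν => selSnd s W ν b₁ (List.range k) = G (selFst s W ν b₀ (List.range k))) j ν ↔
      selSnd s W ν b₁ (List.range' j r) = G^[2 ^ j] (selFst s W ν b₀ (List.range' j r)) := by
  induction j generalizing r ν with
  | zero =>
    obtain rfl : r = k := by omega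
    simp [Game, List.range_eq_range']
  | succ j ih =>
    simp only [Game, ih (r + 1) (by omega)]
    rw [pow_succ, Function.iterate_mul]
    have hl : ∀ i ∈ List.range' (j + 1) r, (j + 1) * levelSize s W ≤ i * levelSize s W := by
      intro i hi
      rw [List.mem_range'_1] at hi
      exact Nat.mul_le_mul_right _ hi.1
    have hcongr : ∀ (u : ℕ → Bool) b i, (j + 1) * levelSize s W ≤ i → Function.update
        (overwrite ν u (j * levelSize s W + 1) ((W + 1) * s)) (j * levelSize s W) b i = ν i := by
      intro u b i hi
      have : (j + 1) * levelSize s W = j * levelSize s W + (W + 1) * s + 1 := by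
        rw [add_mul, one_mul, levelSize]; ring
      rw [Function.update_of_ne (by omega), overwrite, if_neg (by omega)]
    have hA : ∀ u b, selFst s W (Function.update
        (overwrite ν u (j * levelSize s W + 1) ((W + 1) * s)) (j * levelSize s W) b) b₀
          (List.range' (j + 1) r) = selFst s W ν b₀ (List.range' (j + 1) r) :=
      fun u b => selFst_congr hl (hcongr u b)
    have hB : ∀ u b, selSnd s W (Function.update
        (overwrite ν u (j * levelSize s W + 1) ((W + 1) * s)) (j * levelSize s W) b) b₁
          (List.range' (j + 1) r) = selSnd s W ν b₁ (List.range' (j + 1) r) :=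
      fun u b => selSnd_congr hl (hcongr u b)
    -- Both challenges see the same guess, because the universal bit is not part of the stored row.
    have hmid : ∀ u, midCfg s W j (Function.update
          (overwrite ν u (j * levelSize s W + 1) ((W + 1) * s)) (j * levelSize s W) true) =
        midCfg s W j (Function.update
          (overwrite ν u (j * levelSize s W + 1) ((W + 1) * s)) (j * levelSize s W) false) := by
      intro u
      funext i a
      have hb := cellIdx_bounds (s := s) (W := W) j i a
      rw [midCfg, midCfg, Function.update_of_ne (by omega), Function.update_of_ne (by omega)]
    -- The value `false` challenges the half that ends in the middle row, and `true` the half that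
    -- starts there.
    have hsplit : ∀ u, (∀ b, selSnd s W (Function.update
          (overwrite ν u (j * levelSize s W + 1) ((W + 1) * s)) (j * levelSize s W) b) b₁
            (List.range' j (r + 1)) = G^[2 ^ j] (selFst s W (Function.update
          (overwrite ν u (j * levelSize s W + 1) ((W + 1) * s)) (j * levelSize s W) b) b₀
            (List.range' j (r + 1)))) ↔
        midCfg s W j (Function.update
          (overwrite ν u (j * levelSize s W + 1) ((W + 1) * s)) (j * levelSize s W) false) =
            G^[2 ^ j] (selFst s W ν b₀ (List.range' (j + 1) r)) ∧
        selSnd s W ν b₁ (List.range' (j + 1) r) = G^[2 ^ j] (midCfg s W j (Function.update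
          (overwrite ν u (j * levelSize s W + 1) ((W + 1) * s)) (j * levelSize s W) false)) := by
      intro u
      rw [Bool.forall_bool, List.range'_succ]
      have eA := hA u
      have eB := hB u
      simp only [selFst, selSnd] at eA eB
      simp only [selFst, selSnd, List.foldr_cons, Function.update_self, eA, eB, hmid,
        if_true, Bool.false_eq_true, if_false]
    simp only [hsplit]
    constructor
    · rintro ⟨u, h1, h2⟩
      rw [h2, h1]; rfl
    · intro h
      obtain ⟨u, hu⟩ := exists_midCfg (W := W) j
        (G^[2 ^ j] (selFst s W ν b₀ (List.range' (j + 1) r)))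
      refine ⟨u, hu _ _, ?_⟩
      rw [hu, h]
      rfl

end Reach

/-! ### The CTL formulas that express the game. -/

section Formula

variable {s : ℕ} (f : Fin s → Fin s → Fin s → Fin s → Fin s) (W k : ℕ) (c₀ c₁ : ℕ → Fin s)

/-- The formula for the letter `a` in cell `i` of the first selected configuration. -/
def fstF (i : ℕ) (a : Fin s) : CTL Loc :=
  (List.range k).foldr (fun j φ => ite (bitF (j * levelSize s W)) (bitF (cellIdx s W j i a)) φ)
    (ofBool (c₀ i = a))

/-- The formula for the letter `a` in cell `i` of the second selected configuration. -/
def sndF (i : ℕ) (a : Fin s) : CTL Loc :=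
  (List.range k).foldr
    (fun j φ => ite (neg (bitF (j * levelSize s W))) (bitF (cellIdx s W j i a)) φ)
    (ofBool (c₁ i = a))

/-- The letter `d` is in cell `i` of the second selected configuration if and only if it is there
one step after the first selected configuration. -/
noncomputable def cellF (i : ℕ) (d : Fin s) : CTL Loc :=
  iff (sndF W k c₁ i d) (bigDisj ((preimages f d).map fun x =>
    conj (fstF W k c₀ 0 x.1) (conj (fstF W k c₀ (i - 1) x.2.1)
      (conj (fstF W k c₀ i x.2.2.1) (fstF W k c₀ (min (i + 1) W) x.2.2.2)))))

/-- The second selected configuration is the successor of the first one. -/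
noncomputable def stepF : CTL Loc :=
  bigConj ((List.range (W + 1)).map fun i => bigConj ((List.finRange s).map fun d =>
    cellF f W k c₀ c₁ i d))

/-- The formula with `j` levels of quantifiers in front of `stepF`. -/
noncomputable def reachF : ℕ → CTL Loc
  | 0 => stepF f W k c₀ c₁
  | j + 1 => exBlock (j * levelSize s W + 1) ((W + 1) * s) (allQ (j * levelSize s W) (reachF j))

variable {W}

theorem sat_fstF (n : ℕ) (i : Fin (W + 1)) (a : Fin s) : Sat (fstF W k c₀ i a) tbar n ↔
    selFst s W (bits n) (oneHot fun i => c₀ i) (List.range k) i a = true := by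
  rw [fstF, selFst]
  generalize List.range k = l
  induction l with
  | nil => simp [sat_ofBool, oneHot]
  | cons j l ih =>
    simp only [List.foldr_cons, sat_ite, ih, sat_bitF, bits]
    split_ifs with h <;> simp [h, midCfg, bits]

theorem sat_sndF (n : ℕ) (i : Fin (W + 1)) (a : Fin s) : Sat (sndF W k c₁ i a) tbar n ↔
    selSnd s W (bits n) (oneHot fun i => c₁ i) (List.range k) i a = true := by
  rw [sndF, selSnd]
  generalize List.range k = l
  induction l with
  | nil => simp [sat_ofBool, oneHot]
  | cons j l ih =>
    simp only [List.foldr_cons, sat_ite, sat_neg, ih, sat_bitF, bits]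
    split_ifs with h <;> simp [h, midCfg, bits]

theorem sat_stepF (n : ℕ) : Sat (stepF f W k c₀ c₁) tbar n ↔
    selSnd s W (bits n) (oneHot fun i => c₁ i) (List.range k) =
      liftStep f (selFst s W (bits n) (oneHot fun i => c₀ i) (List.range k)) := by
  have hcell : ∀ (i : Fin (W + 1)) (d : Fin s), Sat (cellF f W k c₀ c₁ i d) tbar n ↔
      (selSnd s W (bits n) (oneHot fun i => c₁ i) (List.range k) i d =
        liftStep f (selFst s W (bits n) (oneHot fun i => c₀ i) (List.range k)) i d) := by
    intro i d
    have hb : ∀ (b : Bool) (p : Prop) [Decidable p], b = decide p ↔ (b = true ↔ p) := by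
      intro b p _; cases b <;> simp
    rw [cellF, sat_iff, sat_sndF, sat_bigDisj, liftStep, hb]
    refine iff_congr Iff.rfl ?_
    simp only [List.mem_map, exists_exists_and_eq_and, sat_conj]
    refine exists_congr fun x => and_congr_right fun _ => ?_
    exact and_congr (sat_fstF k c₀ n 0 _) (and_congr (sat_fstF k c₀ n (leftCell i) _)
      (and_congr (sat_fstF k c₀ n i _) (sat_fstF k c₀ n (rightCell i) _)))
  simp only [stepF, sat_bigConj, List.mem_map, List.mem_range, List.mem_finRange, true_and,
    forall_exists_index, and_imp, forall_apply_eq_imp_iff₂, forall_apply_eq_imp_iff]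
  constructor
  · intro h
    funext i d
    exact (hcell i d).1 (h i i.2 d)
  · intro h i hi d
    exact (hcell ⟨i, hi⟩ d).2 (by rw [h])

/-- Level `j` occupies the bits from `j * levelSize s W` up to the next level, with the universal
bit lowest and hence quantified inside the block. The blocks thus stack up without gaps. -/
theorem expresses_reachF (j : ℕ) : Expresses (j * levelSize s W) (reachF f W k c₀ c₁ j)
    (Game s W (fun ν => selSnd s W ν (oneHot fun i => c₁ i) (List.range k) =
      liftStep f (selFst s W ν (oneHot fun i => c₀ i) (List.range k))) j) := by
  induction j with
  | zero => exact fun n _ => sat_stepF f k c₀ c₁ n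
  | succ j ih =>
    have h := (ih.allQ.exBlock ((W + 1) * s))
    rw [show j * levelSize s W + 1 + (W + 1) * s = (j + 1) * levelSize s W by
      rw [add_mul, one_mul, levelSize]; ring] at h
    exact h

/-- The reachability formula holds in `(t̄, 0)` if and only if `2 ^ k` steps of the local automaton
lead from `c₀` to `c₁`. -/
theorem sat_reachF : Sat (reachF f W k c₀ c₁ k) tbar 0 ↔
    (localStep f W)^[2 ^ k] (fun i => c₀ i) = fun i : Fin (W + 1) => c₁ i := by
  rw [expresses_reachF f k c₀ c₁ k 0 (dvd_zero _), game_iff (k := k) k 0 rfl]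
  simp only [List.range'_zero, selSnd, selFst, List.foldr_nil, liftStep_iterate_oneHot]
  rw [oneHot_injective.eq_iff, eq_comm]

end Formula

end CTL

/-! ### From stack machines to local automata -/

/-- Before the first visit to the fixed point `e` the orbit has no repetition, since cutting out a
loop would give an earlier visit. The first visit thus takes at most as many steps as there are
points, and the orbit stays at `e` afterwards. -/
theorem iterate_eq_of_isFixedPt {X : Type} [Fintype X] (F : X → X) {c e : X} {T m : ℕ}
    (hT : F^[T] c = e) (he : F e = e) (hm : Fintype.card X ≤ m) : F^[m] c = e := by
  classical
  have hstay : ∀ n, F^[n] e = e := fun n => Function.iterate_fixed he n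
  have hex : ∃ T, F^[T] c = e := ⟨T, hT⟩
  have hmin := Nat.find_spec hex
  set N := Nat.find hex with hN
  have hle : N ≤ m := by
    by_contra hlt
    have hinj : Function.Injective (fun i : Fin N => F^[(i : ℕ)] c) := by
      intro i j hij
      by_contra hne
      wlog hlt' : (i : ℕ) < j generalizing i j with H
      · exact H hij.symm (Ne.symm hne) (by have := Fin.val_ne_of_ne hne; omega)
      have h1 : F^[N - j + i] c = e := by
        rw [Function.iterate_add_apply]
        dsimp only at hij
        rw [hij, ← Function.iterate_add_apply, Nat.sub_add_cancel j.2.le]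
        exact hmin
      have := Nat.find_min' hex h1
      omega
    have := Fintype.card_le_of_injective _ hinj
    rw [Fintype.card_fin] at this
    omega
  rw [← Nat.sub_add_cancel hle, Function.iterate_add_apply, hmin, hstay]

/-- A local rule can be restricted to a finite set of letters that is closed under it. -/
theorem exists_fin_rule {A : Type} {S : Set A} (hS : S.Finite) (f : A → A → A → A → A)
    (hf : ∀ a ∈ S, ∀ b ∈ S, ∀ c ∈ S, ∀ d ∈ S, f a b c d ∈ S) :
    ∃ (s : ℕ) (e : Fin s → A) (f' : Fin s → Fin s → Fin s → Fin s → Fin s),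
      Function.Injective e ∧ (∀ a ∈ S, ∃ i, e i = a) ∧
        ∀ a b c d, e (f' a b c d) = f (e a) (e b) (e c) (e d) := by
  have := hS.fintype
  let φ := Fintype.equivFin S
  refine ⟨Fintype.card S, fun i => (φ.symm i : A),
    fun a b c d => φ ⟨f (φ.symm a) (φ.symm b) (φ.symm c) (φ.symm d),
      hf _ (φ.symm a).2 _ (φ.symm b).2 _ (φ.symm c).2 _ (φ.symm d).2⟩, ?_, ?_, ?_⟩
  · exact Subtype.val_injective.comp φ.symm.injective
  · exact fun a ha => ⟨φ ⟨a, ha⟩, by simp⟩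
  · intro a b c d; simp

theorem localStep_comp {A B : Type} {f : A → A → A → A → A} {f' : B → B → B → B → B} {e : B → A}
    (h : ∀ a b c d, e (f' a b c d) = f (e a) (e b) (e c) (e d)) (W n : ℕ) (C : Fin (W + 1) → B) :
    (localStep f W)^[n] (e ∘ C) = e ∘ (localStep f' W)^[n] C := by
  have hs : Function.Semiconj (e ∘ · : (Fin (W + 1) → B) → _) (localStep f' W) (localStep f W) := by
    intro C; funext i; simp [localStep, h]
  exact (hs.iterate_right n C).symm

namespace Turing.TM2

open Stmt

/-! ### Elementary steps of stack machines as steps of a local automaton. -/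

section Small

variable {K : Type} [DecidableEq K] {Γ : K → Type} {Λ σ : Type}

/-- The control part of one elementary step: the statement that remains to be executed (`none`
after halting) and the internal state, given the topmost symbols of the stacks. -/
def nextCtl (M : Λ → Stmt Γ Λ σ) :
    Option (Stmt Γ Λ σ) → σ → (∀ k, Option (Γ k)) → Option (Stmt Γ Λ σ) × σ
  | none, v, _ => (none, v)
  | some (push _ _ q), v, _ => (some q, v)
  | some (peek k f q), v, T => (some q, f v (T k))
  | some (pop k f q), v, T => (some q, f v (T k))
  | some (load a q), v, _ => (some q, a v)
  | some (branch p q₁ q₂), v, _ => (some (cond (p v) q₁ q₂), v)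
  | some (goto l), v, _ => (some (M (l v)), v)
  | some halt, v, _ => (none, v)

/-- The effect of one elementary step on the stacks. -/
def nextStk : Option (Stmt Γ Λ σ) → σ → (∀ k, List (Γ k)) → ∀ k, List (Γ k)
  | some (push k f _), v, S => Function.update S k (f v :: S k)
  | some (pop k _ _), _, S => Function.update S k (S k).tail
  | _, _, S => S

/-- The effect of one elementary step on the symbols in a given depth of the stacks. The symbols
above them are `none` for the topmost cell. -/
def nextCell : Option (Stmt Γ Λ σ) → σ → Option (∀ k, Option (Γ k)) → (∀ k, Option (Γ k)) →
    (∀ k, Option (Γ k)) → ∀ k, Option (Γ k)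
  | some (push k f _), v, none, b, _ => Function.update b k (some (f v))
  | some (push k _ _), _, some a, b, _ => Function.update b k (a k)
  | some (pop k _ _), _, _, b, c => Function.update b k (c k)
  | _, _, _, b, _ => b

/-- The letters of the local automaton: control letters and stack letters. -/
abbrev Letter (Γ : K → Type) (Λ σ : Type) : Type :=
  (Option (Stmt Γ Λ σ) × σ) ⊕ (∀ k, Option (Γ k))

/-- The rule of the local automaton: cell `0` carries the control, and cell `i + 1` the symbols in
depth `i` of all the stacks. -/
def localRule (M : Λ → Stmt Γ Λ σ) (z l b r : Letter Γ Λ σ) : Letter Γ Λ σ :=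
  match z, b with
  | .inl (o, v), .inl _ => r.elim (fun _ => b) fun T => .inl (nextCtl M o v T)
  | .inl (o, v), .inr γ => .inr (nextCell o v l.getRight? γ (r.elim (fun _ => γ) id))
  | .inr _, _ => b

/-- A configuration between elementary steps. -/
abbrev SmallCfg (Γ : K → Type) (Λ σ : Type) : Type :=
  (Option (Stmt Γ Λ σ) × σ) × (∀ k, List (Γ k))

/-- One elementary step. -/
def smallStep (M : Λ → Stmt Γ Λ σ) (c : SmallCfg Γ Λ σ) : SmallCfg Γ Λ σ :=
  (nextCtl M c.1.1 c.1.2 fun k => (c.2 k).head?, nextStk c.1.1 c.1.2 c.2)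

/-- The configuration of the local automaton that represents a configuration. -/
def cells (W : ℕ) (c : SmallCfg Γ Λ σ) : Fin (W + 1) → Letter Γ Λ σ :=
  fun i => if (i : ℕ) = 0 then .inl c.1 else .inr fun k => (c.2 k)[(i : ℕ) - 1]?

theorem cells_of_eq_zero {W : ℕ} (c : SmallCfg Γ Λ σ) {i : Fin (W + 1)} (hi : (i : ℕ) = 0) :
    cells W c i = .inl c.1 := if_pos hi

theorem cells_of_eq_succ {W : ℕ} (c : SmallCfg Γ Λ σ) {i : Fin (W + 1)} {j : ℕ}
    (hi : (i : ℕ) = j + 1) : cells W c i = .inr fun k => (c.2 k)[j]? := by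
  rw [cells, if_neg (by omega), hi, Nat.add_sub_cancel]

/-- A push moves the symbols of one stack one cell to the right and a pop moves them one cell to the
left, so every cell needs only its neighbours and the control. The strict bound leaves the last cell
empty, which makes room for a push. -/
theorem localStep_cells (M : Λ → Stmt Γ Λ σ) {W : ℕ} {c : SmallCfg Γ Λ σ}
    (hW : 0 < W) (hc : ∀ k, (c.2 k).length < W) :
    localStep (localRule M) W (cells W c) = cells W (smallStep M c) := by
  obtain ⟨⟨o, v⟩, S⟩ := c
  funext i
  obtain ⟨i, hi⟩ := i
  rw [localStep, cells_of_eq_zero _ (i := 0) rfl]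
  rcases i with _ | i
  · rw [cells_of_eq_zero _ (i := ⟨0, hi⟩) rfl, cells_of_eq_zero _ (i := ⟨0, hi⟩) rfl,
      cells_of_eq_succ _ (j := 0) (i := rightCell ⟨0, hi⟩) (by simp [rightCell]; omega)]
    simp [localRule, smallStep, List.head?_eq_getElem?]
  · have hl : (cells W ((o, v), S) (leftCell ⟨i + 1, hi⟩)).getRight? =
        if i = 0 then none else some fun k => (S k)[i - 1]? := by
      rcases i with _ | i
      · rw [cells_of_eq_zero _ (by simp [leftCell])]; rfl
      · rw [cells_of_eq_succ _ (j := i) (by simp [leftCell])]; simp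
    -- The last cell is its own right neighbour; this is harmless since both depths are beyond the
    -- ends of the stacks.
    have hr : cells W ((o, v), S) (rightCell ⟨i + 1, hi⟩) = .inr fun k => (S k)[i + 1]? := by
      rcases Nat.lt_or_ge (i + 1) W with h | h
      · rw [cells_of_eq_succ _ (j := i + 1) (by simp [rightCell]; omega)]
      · rw [cells_of_eq_succ _ (j := i) (by simp [rightCell]; omega)]
        congr 1
        funext k
        have := hc k
        dsimp only at this ⊢
        rw [List.getElem?_eq_none (by omega), List.getElem?_eq_none (by omega)]
    rw [cells_of_eq_succ _ (j := i) (i := ⟨i + 1, hi⟩) rfl,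
      cells_of_eq_succ _ (j := i) (i := ⟨i + 1, hi⟩) rfl]
    simp only [localRule, hl, hr, Sum.elim_inr, id, smallStep]
    congr 1
    funext k'
    rcases o with _ | q
    · rfl
    cases q with
    | push k f q =>
      rcases i with _ | i
      · simp only [nextCell, nextStk, if_true]
        rcases eq_or_ne k' k with rfl | hk <;> simp [*]
      · simp only [nextCell, nextStk, Nat.add_eq_zero_iff, one_ne_zero, and_false, if_false]
        rcases eq_or_ne k' k with rfl | hk <;> simp [*]
    | pop k f q =>
      simp only [nextCell, nextStk]
      rcases eq_or_ne k' k with rfl | hk <;> simp [*]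
    | _ => rfl

theorem smallStep_length (M : Λ → Stmt Γ Λ σ) (c : SmallCfg Γ Λ σ) (k : K) :
    ((smallStep M c).2 k).length ≤ (c.2 k).length + 1 := by
  obtain ⟨⟨o, v⟩, S⟩ := c
  simp only [smallStep]
  rcases o with _ | q
  · simp [nextStk]
  cases q with
  | push k' f q =>
    rcases eq_or_ne k k' with rfl | hk <;> simp [nextStk, *]
  | pop k' f q =>
    rcases eq_or_ne k k' with rfl | hk <;> simp [nextStk, *]; omega
  | _ => simp [nextStk]

theorem smallStep_iterate_length (M : Λ → Stmt Γ Λ σ) (c : SmallCfg Γ Λ σ) (k : K) (m : ℕ) :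
    (((smallStep M)^[m] c).2 k).length ≤ (c.2 k).length + m := by
  induction m with
  | zero => simp
  | succ m ih =>
    rw [Function.iterate_succ_apply']
    have := smallStep_length M ((smallStep M)^[m] c) k
    omega

/-- A configuration of the stack machine, as a configuration between elementary steps. -/
def Cfg.toSmall (M : Λ → Stmt Γ Λ σ) (c : Cfg Γ Λ σ) : SmallCfg Γ Λ σ := ((c.l.map M, c.var), c.stk)

/-- An upper bound on the number of elementary steps in a statement. -/
def Stmt.depth : Stmt Γ Λ σ → ℕ
  | push _ _ q => q.depth + 1
  | peek _ _ q => q.depth + 1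
  | pop _ _ q => q.depth + 1
  | load _ q => q.depth + 1
  | branch _ q₁ q₂ => q₁.depth + q₂.depth + 1
  | goto _ => 1
  | halt => 1

/-- The number of elementary steps depends on the branches taken; the bound by `depth` limits how
far the stacks can grow inside one machine step. -/
theorem smallStep_stepAux (M : Λ → Stmt Γ Λ σ) (q : Stmt Γ Λ σ) (v : σ) (S : ∀ k, List (Γ k)) :
    ∃ m ≤ q.depth, (smallStep M)^[m] ((some q, v), S) = (stepAux q v S).toSmall M := by
  induction q generalizing v S with
  | branch p q₁ q₂ ih₁ ih₂ =>
    rcases hp : p v with _ | _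
    · obtain ⟨m, hm, h⟩ := ih₂ v S
      refine ⟨m + 1, by simp only [Stmt.depth]; omega, ?_⟩
      rw [Function.iterate_succ_apply, stepAux, hp, cond_false, ← h]
      simp [smallStep, nextCtl, nextStk, hp]
    · obtain ⟨m, hm, h⟩ := ih₁ v S
      refine ⟨m + 1, by simp only [Stmt.depth]; omega, ?_⟩
      rw [Function.iterate_succ_apply, stepAux, hp, cond_true, ← h]
      simp [smallStep, nextCtl, nextStk, hp]
  | goto l => exact ⟨1, le_rfl, rfl⟩
  | halt => exact ⟨1, le_rfl, rfl⟩
  | push k f q ih =>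
    obtain ⟨m, hm, h⟩ := ih v (Function.update S k (f v :: S k))
    exact ⟨m + 1, by simp only [Stmt.depth]; omega, h⟩
  | peek k f q ih =>
    obtain ⟨m, hm, h⟩ := ih (f v (S k).head?) S
    exact ⟨m + 1, by simp only [Stmt.depth]; omega, h⟩
  | pop k f q ih =>
    obtain ⟨m, hm, h⟩ := ih (f v (S k).head?) (Function.update S k (S k).tail)
    exact ⟨m + 1, by simp only [Stmt.depth]; omega, h⟩
  | load a q ih =>
    obtain ⟨m, hm, h⟩ := ih (a v) S
    exact ⟨m + 1, by simp only [Stmt.depth]; omega, h⟩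

theorem localStep_iterate_cells (M : Λ → Stmt Γ Λ σ) {W m : ℕ} {c : SmallCfg Γ Λ σ}
    (hc : ∀ k, (c.2 k).length + m < W) (hW : 0 < W) :
    (localStep (localRule M) W)^[m] (cells W c) = cells W ((smallStep M)^[m] c) := by
  induction m with
  | zero => rfl
  | succ m ih =>
    rw [Function.iterate_succ_apply', Function.iterate_succ_apply',
      ih fun k => by have := hc k; omega]
    refine localStep_cells M hW fun k => ?_
    have h1 := hc k
    have h2 := smallStep_iterate_length M c k m
    omega

/-- A halting computation in bounded space is followed by the local automaton. -/
theorem exists_iterate_cells (M : Λ → Stmt Γ Λ σ) {W D B : ℕ} (hD : ∀ l, (M l).depth ≤ D)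
    (hW : B + D < W) (n : ℕ) (c c' : Cfg Γ Λ σ)
    (hB : ∀ c'', StateTransition.Reaches (step M) c c'' → ∀ k, (c''.stk k).length ≤ B)
    (h : (flip bind (step M))^[n] (some c) = some c') :
    StateTransition.Reaches (step M) c c' ∧
    ∃ T, (localStep (localRule M) W)^[T] (cells W (c.toSmall M)) = cells W (c'.toSmall M) := by
  induction n generalizing c with
  | zero =>
    obtain rfl : c = c' := by simpa using h
    exact ⟨Relation.ReflTransGen.refl, 0, rfl⟩
  | succ n ih =>
    rw [Function.iterate_succ_apply] at h
    have hnone : ∀ n, (flip bind (step M))^[n] none = none := by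
      intro n
      exact Function.iterate_fixed rfl n
    rcases hs : step M c with _ | c₁
    · have : flip bind (step M) (some c) = none := hs
      rw [this, hnone] at h
      cases h
    · have hb : flip bind (step M) (some c) = some c₁ := hs
      rw [hb] at h
      have hr : StateTransition.Reaches (step M) c c₁ := Relation.ReflTransGen.single hs
      obtain ⟨hr', T, hT⟩ := ih c₁ (fun c'' hc'' => hB c'' (hr.trans hc'')) h
      refine ⟨hr.trans hr', ?_⟩
      have hlen := hB c Relation.ReflTransGen.refl
      obtain ⟨_ | l, v, S⟩ := c
      · cases hs
      simp only [step, Option.some.injEq] at hs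
      obtain ⟨m, hm, hms⟩ := smallStep_stepAux M (M l) v S
      refine ⟨T + m, ?_⟩
      rw [Function.iterate_add_apply, ← hT, ← hs, ← hms]
      congr 1
      refine localStep_iterate_cells M (fun k => ?_) (by omega)
      have h1 := hlen k
      have h2 := hD l
      simp only [Cfg.toSmall] at h1 ⊢
      omega

/-! #### A finite alphabet -/

/-- The symbol that a statement pushes first, if it starts with a push. -/
def pushed : Option (Stmt Γ Λ σ) → σ → ∀ k, Option (Γ k)
  | some (push k f _), v => Function.update (fun _ => none) k (some (f v))
  | _, _ => fun _ => none

/-- The letters that can occur in a computation whose initial stacks are empty except for `k₀`,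
and the symbols of one further stack letter `E`. -/
def letters [Fintype Λ] (M : Λ → Stmt Γ Λ σ) (k₀ : K)
    (E : ∀ k, Option (Γ k)) : Set (Letter Γ Λ σ) :=
  {x | match x with
    | .inl (o, _) => o ∈ stmts M Finset.univ
    | .inr γ => ∀ k, k = k₀ ∨ γ k = none ∨ γ k = E k ∨
        ∃ o ∈ stmts M Finset.univ, ∃ v, pushed o v k = γ k}

/-- Only the alphabet of stack `k₀` is assumed finite. On any other stack, the symbols that can
arise by pushing are the values of `pushed` on finitely many statements and internal states. -/
theorem finite_letters [Fintype Λ] [Fintype K] [Fintype σ] (M : Λ → Stmt Γ Λ σ) (k₀ : K)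
    [Fintype (Γ k₀)] (E : ∀ k, Option (Γ k)) : (letters M k₀ E).Finite := by
  have h1 : {γ : ∀ k, Option (Γ k) | ∀ k, k = k₀ ∨ γ k = none ∨ γ k = E k ∨
      ∃ o ∈ stmts M Finset.univ, ∃ v, pushed o v k = γ k}.Finite := by
    have hk : ∀ k, {g : Option (Γ k) | k = k₀ ∨ g = none ∨ g = E k ∨
        ∃ o ∈ stmts M Finset.univ, ∃ v, pushed o v k = g}.Finite := by
      intro k
      rcases eq_or_ne k k₀ with rfl | hk
      · exact Set.toFinite _
      · have : {g : Option (Γ k) | k = k₀ ∨ g = none ∨ g = E k ∨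
            ∃ o ∈ stmts M Finset.univ, ∃ v, pushed o v k = g} ⊆ {none, E k} ∪
            (fun x : Option (Stmt Γ Λ σ) × σ => pushed x.1 x.2 k) ''
              ((stmts M Finset.univ : Finset _) ×ˢ (Set.univ : Set σ) : Set _) := by
          rintro g (h | h | h | ⟨o, ho, v, h⟩)
          · exact absurd h hk
          · exact Or.inl (Or.inl h)
          · exact Or.inl (Or.inr h)
          · exact Or.inr ⟨(o, v), ⟨ho, trivial⟩, h⟩
        exact ((Set.toFinite _).union
          (((Finset.finite_toSet _).prod Set.finite_univ).image _)).subset this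
    exact (Set.Finite.pi hk).subset fun γ hγ k _ => hγ k
  have h2 : ((stmts M Finset.univ : Finset _) ×ˢ (Set.univ : Set σ) :
      Set (Option (Stmt Γ Λ σ) × σ)).Finite :=
    (Finset.finite_toSet _).prod Set.finite_univ
  refine ((h2.image Sum.inl).union (h1.image Sum.inr)).subset ?_
  rintro (⟨o, v⟩ | γ) hx
  · exact Or.inl ⟨(o, v), ⟨hx, trivial⟩, rfl⟩
  · exact Or.inr ⟨γ, hx, rfl⟩

theorem some_mem_stmts [Fintype Λ] (M : Λ → Stmt Γ Λ σ) (l : Λ) :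
    some (M l) ∈ stmts M Finset.univ := by
  simp only [stmts, Finset.some_mem_insertNone, Finset.mem_biUnion]
  exact ⟨l, Finset.mem_univ _, stmts₁_self⟩

theorem nextCtl_mem_stmts [Fintype Λ] (M : Λ → Stmt Γ Λ σ) {o : Option (Stmt Γ Λ σ)} (v : σ)
    (T : ∀ k, Option (Γ k)) (ho : o ∈ stmts M Finset.univ) :
    (nextCtl M o v T).1 ∈ stmts M Finset.univ := by
  classical
  rcases o with _ | q
  · exact ho
  cases q with
  | goto l => exact some_mem_stmts M _
  | halt => simp [nextCtl, stmts]
  | branch p q₁ q₂ =>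
    refine stmts_trans ?_ ho
    rcases hp : p v <;> simp [stmts₁, stmts₁_self]
  | _ => exact stmts_trans (by simp [stmts₁, stmts₁_self]) ho

/-- Membership is a condition on each stack separately. The rule either copies symbols of
neighbouring cells stack by stack or inserts a symbol that a statement pushes. -/
theorem localRule_mem_letters [Fintype Λ] (M : Λ → Stmt Γ Λ σ) (k₀ : K)
    (E : ∀ k, Option (Γ k)) : ∀ z ∈ letters M k₀ E, ∀ l ∈ letters M k₀ E, ∀ b ∈ letters M k₀ E,
      ∀ r ∈ letters M k₀ E,
      localRule M z l b r ∈ letters M k₀ E := by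
  rintro (⟨o, v⟩ | γz) hz l hl (ob | b) hb r hr
  · rcases r with r | T
    · exact hb
    · exact nextCtl_mem_stmts M v T hz
  · have hc : (Sum.inr (r.elim (fun _ => b) id) : Letter Γ Λ σ) ∈ letters M k₀ E := by
      rcases r with r | T
      · exact hb
      · exact hr
    simp only [localRule]
    generalize r.elim (fun _ => b) id = c at hc
    rcases o with _ | q
    · exact hb
    cases q with
    | push k f q =>
      rcases l with l | a
      · intro k'
        rcases eq_or_ne k' k with rfl | hk
        · exact Or.inr (Or.inr (Or.inr ⟨_, hz, v, by simp [pushed, nextCell]⟩))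
        · simpa [nextCell, hk] using hb k'
      · intro k'
        rcases eq_or_ne k' k with rfl | hk
        · simpa [nextCell] using hl k'
        · simpa [nextCell, hk] using hb k'
    | pop k f q =>
      intro k'
      rcases eq_or_ne k' k with rfl | hk
      · simpa [nextCell] using hc k'
      · simpa [nextCell, hk] using hb k'
    | _ => exact hb
  · exact hb
  · exact hb

end Small

end Turing.TM2

/-- The initial configuration of a local automaton on the input `x`. -/
def inputCell {A : Type} (z tt ff blank : A) (x : List Bool) (i : ℕ) : A :=
  if i = 0 then z else (x[i - 1]?).elim blank fun b => cond b tt ff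

/-- The final configuration of a local automaton. -/
def outputCell {A : Type} (z o blank : A) (i : ℕ) : A :=
  if i = 0 then z else if i = 1 then o else blank

/-! ### Initial and final stacks, read depth by depth. -/

namespace Turing

/-- Reducing to one-symbol inputs shows that a single letter per input bit suffices, and it hides
the transport along `k = tm.k₀`. -/
theorem initList_stk_getElem? (tm : FinTM2) (l : List (tm.Γ tm.k₀)) (k : tm.K) (i : ℕ) :
    ((initList tm l).stk k)[i]? =
      (l[i]?).elim none fun a => ((initList tm [a]).stk k)[0]? := by
  by_cases hk : k = tm.k₀
  · subst hk
    simp only [initList, dif_pos]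
    rcases h : l[i]? <;> simp [h]
  · simp only [initList, dif_neg hk]
    rcases h : l[i]? <;> simp

theorem haltList_stk_getElem? (tm : FinTM2) (a : tm.Γ tm.k₁) (k : tm.K) (i : ℕ) :
    ((haltList tm [a]).stk k)[i]? =
      if i = 0 then ((haltList tm [a]).stk k)[0]? else none := by
  split_ifs with hi
  · rw [hi]
  · obtain ⟨i, rfl⟩ := Nat.exists_eq_succ_of_ne_zero hi
    by_cases hk : k = tm.k₁
    · subst hk; simp [haltList]
    · simp [haltList, dif_neg hk]

end Turing

open Turing in
/-- Every language in PSPACE is decided by a local automaton on polynomially many cells. -/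
theorem InPSPACE.exists_localStep {L : Set (List Bool)} (hL : InPSPACE L) :
    ∃ (s : ℕ) (f : Fin s → Fin s → Fin s → Fin s → Fin s) (z₀ tt ff blank z₁ o : Fin s)
      (p : Polynomial ℕ), ∀ x, x ∈ L ↔
        (localStep f (p.eval x.length))^[2 ^ (s * (p.eval x.length + 1))]
          (fun i => inputCell z₀ tt ff blank x i) =
            fun i : Fin (p.eval x.length + 1) => outputCell z₁ o blank i := by
  obtain ⟨χ, ⟨⟨tm, eIn, eOut⟩, hout⟩, p, hχ, hp⟩ := hL
  let _ := tm.kFin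
  let _ := tm.ΛFin
  let _ := tm.σFin
  let _ := tm.Γk₀Fin
  let _ := tm.kDecidableEq
  have hp' : ∀ (x : List Bool) c, StateTransition.Reaches tm.step (initList tm (x.map eIn.symm)) c →
      cfgSpace tm c ≤ p.eval x.length := hp
  have hout' : ∀ x : List Bool, TM2Outputs tm (x.map eIn.symm) (some [eOut.symm (χ x)]) := hout
  -- The top cell of the accepting configuration. It is added to the alphabet by hand, as nothing
  -- guarantees that the machine ever pushes this symbol.
  set E : ∀ k, Option (tm.Γ k) := fun k => ((haltList tm [eOut.symm true]).stk k)[0]? with hE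
  obtain ⟨s, e, f', he, hsurj, hf'⟩ := exists_fin_rule (TM2.finite_letters tm.m tm.k₀ E)
    (TM2.localRule tm.m) (TM2.localRule_mem_letters tm.m tm.k₀ E)
  set D := Finset.univ.sup fun l => (tm.m l).depth with hD
  have hDle : ∀ l, (tm.m l).depth ≤ D := fun l =>
    Finset.le_sup (f := fun l => (tm.m l).depth) (Finset.mem_univ l)
  -- the letters of the initial and final configurations
  obtain ⟨z₀, hz₀⟩ := hsurj (.inl (some (tm.m tm.main), tm.initialState))
    (TM2.some_mem_stmts tm.m tm.main)
  obtain ⟨z₁, hz₁⟩ := hsurj (.inl (none, tm.initialState)) (by simp [TM2.letters, TM2.stmts])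
  have hin : ∀ b, ∃ i, e i = .inr fun k => ((initList tm [eIn.symm b]).stk k)[0]? := by
    intro b
    refine hsurj _ fun k => ?_
    by_cases hk : k = tm.k₀
    · exact Or.inl hk
    · exact Or.inr (Or.inl (by simp [initList, dif_neg hk]))
  obtain ⟨tt, htt⟩ := hin true
  obtain ⟨ff, hff⟩ := hin false
  obtain ⟨blank, hblank⟩ := hsurj (.inr fun _ => none) fun k => Or.inr (Or.inl rfl)
  obtain ⟨o, ho⟩ := hsurj (.inr E) fun k => Or.inr (Or.inr (Or.inl rfl))
  -- The summand `D` pays for the growth of the stacks inside one machine step, and `1` for the cell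
  -- that must stay empty.
  refine ⟨s, f', z₀, tt, ff, blank, z₁, o, p + Polynomial.C (D + 1), fun x => ?_⟩
  generalize hW : (p + Polynomial.C (D + 1)).eval x.length = W
  rw [Polynomial.eval_add, Polynomial.eval_C] at hW
  have hc₀ : e ∘ (fun i : Fin (W + 1) => inputCell z₀ tt ff blank x i) =
      TM2.cells W ((initList tm (x.map eIn.symm)).toSmall tm.m) := by
    funext i
    obtain ⟨_ | i, hi⟩ := i
    · rw [TM2.cells_of_eq_zero _ rfl]
      exact hz₀
    · rw [TM2.cells_of_eq_succ _ (j := i) rfl]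
      have hstk := fun k => initList_stk_getElem? tm (x.map eIn.symm) k i
      simp only [Function.comp, inputCell, Nat.add_eq_zero_iff, one_ne_zero, and_false, if_false,
        Nat.add_sub_cancel, TM2.Cfg.toSmall, hstk, List.getElem?_map]
      rcases x[i]? with _ | _ | _
      · exact hblank
      · exact hff
      · exact htt
  have hc₁ : e ∘ (fun i : Fin (W + 1) => outputCell z₁ o blank i) =
      TM2.cells W ((haltList tm [eOut.symm true]).toSmall tm.m) := by
    funext i
    obtain ⟨_ | _ | i, hi⟩ := i
    · rw [TM2.cells_of_eq_zero _ rfl]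
      exact hz₁
    · rw [TM2.cells_of_eq_succ _ (j := 0) rfl]
      exact ho
    · rw [TM2.cells_of_eq_succ _ (j := i + 1) rfl]
      simp only [TM2.Cfg.toSmall, haltList_stk_getElem? tm _ _ (i + 1)]
      exact hblank
  have hspace : ∀ c, StateTransition.Reaches tm.step (initList tm (x.map eIn.symm)) c →
      ∀ k, (TM2.Cfg.stk c k).length ≤ p.eval x.length := by
    intro c hc k
    refine le_trans ?_ (hp' x c hc)
    exact Finset.single_le_sum (f := fun k => (TM2.Cfg.stk c k).length) (fun _ _ => Nat.zero_le _)
      (Finset.mem_univ k)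
  obtain ⟨hr, T, hT⟩ := TM2.exists_iterate_cells tm.m (W := W) hDle (by omega) (hout' x).steps
    (initList tm (x.map eIn.symm)) (haltList tm [eOut.symm (χ x)]) hspace
    (hout' x).evals_in_steps
  rw [← hc₀, localStep_comp hf'] at hT
  have heinj : Function.Injective (e ∘ · : (Fin (W + 1) → Fin s) → _) := he.comp_left
  -- After halting, the control letter `none` changes nothing, so the final row is a fixed point.
  have hfix : localStep f' W ((localStep f' W)^[T] fun i => inputCell z₀ tt ff blank x i) =
      (localStep f' W)^[T] fun i => inputCell z₀ tt ff blank x i := by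
    apply heinj
    have h1 := localStep_comp hf' W 1 ((localStep f' W)^[T] fun i => inputCell z₀ tt ff blank x i)
    simp only [Function.iterate_one] at h1
    dsimp only
    rw [← h1, hT, TM2.localStep_cells tm.m (by omega)]
    · rfl
    · intro k
      have := hspace _ hr k
      exact lt_of_le_of_lt this (by omega)
  -- There are `s ^ (W + 1)` rows, and `s ≤ 2 ^ s`.
  have hcard : Fintype.card (Fin (W + 1) → Fin s) ≤ 2 ^ (s * (W + 1)) := by
    rw [Fintype.card_fun, Fintype.card_fin, Fintype.card_fin, pow_mul]
    exact Nat.pow_le_pow_left Nat.lt_two_pow_self.le _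
  rw [iterate_eq_of_isFixedPt _ rfl hfix hcard, ← heinj.eq_iff, hT, hc₁, ← hχ]
  constructor
  · intro h
    rw [h]
  · intro h
    -- Cell 1 carries the answer: the halting rows for the two truth values differ there on the
    -- output stack.
    have h1 := congrFun h (1 : Fin (W + 1))
    have hone : ((1 : Fin (W + 1)) : ℕ) = 0 + 1 := by
      rw [Fin.val_one', Nat.mod_eq_of_lt (by omega)]
    rw [TM2.cells_of_eq_succ _ hone, TM2.cells_of_eq_succ _ hone, Sum.inr.injEq] at h1
    have h2 := congrFun h1 tm.k₁
    simpa [TM2.Cfg.toSmall, haltList] using h2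

/-! ### Structured programs

Programs that work on unary registers, on the input, on one further stack of bits, and that write
their output from right to left. -/

/-- The memory of a program. -/
structure Mem (O : Type) where
  reg : ℕ → ℕ
  inp : List Bool
  aux : List Bool
  out : List O

/-- Elementary instructions. -/
inductive Op (O : Type) where
  | inc (r : ℕ)
  | dec (r : ℕ)
  | emit (a : O)
  | inpToAux
  | auxToInp
  | dropInp

/-- Tests. -/
inductive Test where
  | pos (r : ℕ)
  | inpNonempty
  | auxNonempty
  | inpTrue

/-- Structured programs. -/
inductive Prog (O : Type) where
  | op (i : Op O)
  | seq (p q : Prog O)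
  | loop (c : Test) (p : Prog O)
  | when (c : Test) (p : Prog O)

namespace Op

/-- The effect of an instruction. -/
def run {O : Type} : Op O → Mem O → Mem O
  | inc r, s => { s with reg := Function.update s.reg r (s.reg r + 1) }
  | dec r, s => { s with reg := Function.update s.reg r (s.reg r - 1) }
  | emit a, s => { s with out := a :: s.out }
  | inpToAux, s => { s with inp := s.inp.tail, aux := s.inp.head?.toList ++ s.aux }
  | auxToInp, s => { s with aux := s.aux.tail, inp := s.aux.head?.toList ++ s.inp }
  | dropInp, s => { s with inp := s.inp.tail }

/-- A strict upper bound on the registers of an instruction. -/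
def bound {O : Type} : Op O → ℕ
  | inc r => r + 1
  | dec r => r + 1
  | _ => 0

end Op

namespace Test

/-- The outcome of a test. -/
def holds {O : Type} : Test → Mem O → Bool
  | pos r, s => 0 < s.reg r
  | inpNonempty, s => s.inp.head?.isSome
  | auxNonempty, s => s.aux.head?.isSome
  | inpTrue, s => s.inp.head? == some true

/-- A strict upper bound on the registers of a test. -/
def bound : Test → ℕ
  | pos r => r + 1
  | _ => 0

end Test

namespace Prog

variable {O : Type}

/-- `Exec p s n t`: the program `p` transforms the memory `s` into `t` in `n` steps. -/
inductive Exec : Prog O → Mem O → ℕ → Mem O → Prop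
  | op (i : Op O) (s : Mem O) : Exec (.op i) s 1 (i.run s)
  | seq {p q : Prog O} {s s' s'' : Mem O} {m n : ℕ} :
      Exec p s m s' → Exec q s' n s'' → Exec (.seq p q) s (m + n) s''
  | loop_done {c : Test} (p : Prog O) {s : Mem O} : c.holds s = false → Exec (.loop c p) s 1 s
  | loop_next {c : Test} {p : Prog O} {s s' s'' : Mem O} {m n : ℕ} : c.holds s = true →
      Exec p s m s' → Exec (.loop c p) s' n s'' → Exec (.loop c p) s (1 + m + 1 + n) s''
  | when_skip {c : Test} (p : Prog O) {s : Mem O} : c.holds s = false → Exec (.when c p) s 1 s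
  | when_next {c : Test} {p : Prog O} {s t : Mem O} {m : ℕ} : c.holds s = true →
      Exec p s m t → Exec (.when c p) s (1 + m) t

/-- A strict upper bound on the registers of a program. -/
def bound : Prog O → ℕ
  | op i => i.bound
  | seq p q => max p.bound q.bound
  | loop c p => max c.bound p.bound
  | when c p => max c.bound p.bound

/-- The length of the compiled program. -/
def size : Prog O → ℕ
  | op _ => 1
  | seq p q => p.size + q.size
  | loop _ p => p.size + 2
  | when _ p => p.size + 1

/-- Instructions of compiled programs. -/
inductive Instr (O : Type) where
  | op (i : Op O)
  | jumpUnless (c : Test) (a : ℕ)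
  | jump (a : ℕ)

/-- The compiled program, placed at address `a`. -/
def compile : Prog O → ℕ → List (Instr O)
  | op i, _ => [.op i]
  | seq p q, a => p.compile a ++ q.compile (a + p.size)
  | loop c p, a => .jumpUnless c (a + p.size + 2) :: (p.compile (a + 1) ++ [.jump a])
  | when c p, a => .jumpUnless c (a + p.size + 1) :: p.compile (a + 1)

theorem length_compile (p : Prog O) (a : ℕ) : (p.compile a).length = p.size := by
  induction p generalizing a with
  | op i => rfl
  | seq p q ihp ihq => simp [compile, size, ihp, ihq]
  | loop c p ih => simp [compile, size, ih]
  | when c p ih => simp [compile, size, ih]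

/-- The stacks of the machine that executes a compiled program with `R` registers. -/
inductive Stk (R : ℕ) where
  | inp | aux | out
  | reg (r : Fin R)
  deriving DecidableEq

/-- The stacks as a sum type. -/
def Stk.equiv (R : ℕ) : Stk R ≃ Fin 3 ⊕ Fin R where
  toFun
    | .inp => .inl 0
    | .aux => .inl 1
    | .out => .inl 2
    | .reg r => .inr r
  invFun
    | .inl 0 => .inp
    | .inl 1 => .aux
    | .inl 2 => .out
    | .inr r => .reg r
  left_inv x := by cases x <;> rfl
  right_inv x := by
    rcases x with i | r
    · fin_cases i <;> rfl
    · rfl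

instance (R : ℕ) : Fintype (Stk R) := Fintype.ofEquiv _ (Stk.equiv R).symm

/-- The alphabets of the stacks. -/
@[reducible] def Stk.Alphabet (O : Type) {R : ℕ} : Stk R → Type
  | .inp => Bool
  | .aux => Bool
  | .out => O
  | .reg _ => Unit

/-- The contents of the stacks. -/
def Mem.stk {O : Type} (R : ℕ) (s : Mem O) : ∀ k : Stk R, List (k.Alphabet O)
  | .inp => s.inp
  | .aux => s.aux
  | .out => s.out
  | .reg r => List.replicate (s.reg r) ()

open Turing TM2.Stmt

/-- Continue at `l₁` if the topmost symbol of stack `k` passes the test, and at `l₀` otherwise. -/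
def branchOn {R : ℕ} {Λ : Type} (k : Stk R) (test : Option (k.Alphabet O) → Bool) (l₁ l₀ : Λ) :
    TM2.Stmt (Stk.Alphabet O (R := R)) Λ (Option Bool) :=
  peek k (fun _ x => cond (test x) (some true) none)
    (branch Option.isSome (load (fun _ => none) (goto fun _ => l₁)) (goto fun _ => l₀))

/-- The statement that performs an elementary instruction and continues at `l`. -/
def opStmt (R : ℕ) {Λ : Type} (l : Λ) : Op O → TM2.Stmt (Stk.Alphabet O (R := R)) Λ (Option Bool)
  | .inc r => if h : r < R then push (.reg ⟨r, h⟩) (fun _ => ()) (goto fun _ => l)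
      else goto fun _ => l
  | .dec r => if h : r < R then pop (.reg ⟨r, h⟩) (fun v _ => v) (goto fun _ => l)
      else goto fun _ => l
  | .emit a => push .out (fun _ => a) (goto fun _ => l)
  | .inpToAux => pop .inp (fun _ x => x) (branch Option.isSome
      (push .aux (fun v => v.getD false) (load (fun _ => none) (goto fun _ => l)))
      (goto fun _ => l))
  | .auxToInp => pop .aux (fun _ x => x) (branch Option.isSome
      (push .inp (fun v => v.getD false) (load (fun _ => none) (goto fun _ => l)))
      (goto fun _ => l))
  | .dropInp => pop .inp (fun v _ => v) (goto fun _ => l)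

/-- The statement that performs a test. -/
def testStmt (R : ℕ) {Λ : Type} (l₁ l₀ : Λ) :
    Test → TM2.Stmt (Stk.Alphabet O (R := R)) Λ (Option Bool)
  | .pos r => if h : r < R then branchOn (.reg ⟨r, h⟩) Option.isSome l₁ l₀ else goto fun _ => l₀
  | .inpNonempty => branchOn .inp Option.isSome l₁ l₀
  | .auxNonempty => branchOn .aux Option.isSome l₁ l₀
  | .inpTrue => branchOn .inp (fun x : Option Bool => x == some true) l₁ l₀

/-- The machine that executes a list of instructions. -/
def machine (R : ℕ) (code : List (Instr O)) (l : Fin (code.length + 1)) :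
    TM2.Stmt (Stk.Alphabet O (R := R)) (Fin (code.length + 1)) (Option Bool) :=
  match code[(l : ℕ)]? with
  | some (.op i) => opStmt R (Fin.ofNat _ (l + 1)) i
  | some (.jumpUnless c a) => testStmt R (Fin.ofNat _ (l + 1)) (Fin.ofNat _ a) c
  | some (.jump a) => goto fun _ => Fin.ofNat _ a
  | none => halt

/-- The internal state serves only as a scratch bit and is back to `none` afterwards, as the
prescribed halting configuration requires. -/
theorem stepAux_branchOn {R : ℕ} {Λ : Type} (k : Stk R) (test : Option (k.Alphabet O) → Bool)
    (l₁ l₀ : Λ) (S : ∀ k : Stk R, List (k.Alphabet O)) :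
    TM2.stepAux (branchOn k test l₁ l₀) none S =
      ⟨some (cond (test (S k).head?) l₁ l₀), none, S⟩ := by
  rcases h : test (S k).head? <;> simp [branchOn, h]

theorem stepAux_opStmt {R : ℕ} {Λ : Type} (l : Λ) (i : Op O) (hi : i.bound ≤ R) (s : Mem O) :
    TM2.stepAux (opStmt R l i) none (Mem.stk R s) = ⟨some l, none, Mem.stk R (i.run s)⟩ := by
  cases i with
  | inc r =>
    rw [opStmt, dif_pos (show r < R from hi)]
    simp only [TM2.stepAux, TM2.Cfg.mk.injEq, true_and]
    funext k
    cases k with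
    | reg r' =>
      by_cases h : r' = ⟨r, hi⟩
      · subst h; simp [Mem.stk, Op.run, List.replicate_succ]
      · have : (r' : ℕ) ≠ r := fun h' => h (Fin.ext h')
        simp [Mem.stk, Op.run, h, this]
    | _ => simp [Mem.stk, Op.run]
  | dec r =>
    rw [opStmt, dif_pos (show r < R from hi)]
    simp only [TM2.stepAux, TM2.Cfg.mk.injEq, true_and]
    funext k
    cases k with
    | reg r' =>
      by_cases h : r' = ⟨r, hi⟩
      · subst h; simp [Mem.stk, Op.run]
      · have : (r' : ℕ) ≠ r := fun h' => h (Fin.ext h')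
        simp [Mem.stk, Op.run, h, this]
    | _ => simp [Mem.stk, Op.run]
  | emit a =>
    simp only [opStmt, TM2.stepAux, TM2.Cfg.mk.injEq, true_and]
    funext k
    cases k <;> simp [Mem.stk, Op.run]
  | inpToAux =>
    obtain ⟨reg, _ | ⟨b, inp⟩, aux, out⟩ := s <;>
    simp only [opStmt, TM2.stepAux, Mem.stk, List.head?_nil, List.head?_cons, Option.isSome,
      cond_true, cond_false, TM2.Cfg.mk.injEq, true_and, Option.getD] <;>
    funext k <;> cases k <;> simp [Mem.stk, Op.run]
  | auxToInp =>
    obtain ⟨reg, inp, _ | ⟨b, aux⟩, out⟩ := s <;>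
    simp only [opStmt, TM2.stepAux, Mem.stk, List.head?_nil, List.head?_cons, Option.isSome,
      cond_true, cond_false, TM2.Cfg.mk.injEq, true_and, Option.getD] <;>
    funext k <;> cases k <;> simp [Mem.stk, Op.run]
  | dropInp =>
    simp only [opStmt, TM2.stepAux, TM2.Cfg.mk.injEq, true_and]
    funext k
    cases k <;> simp [Mem.stk, Op.run]

theorem stepAux_testStmt {R : ℕ} {Λ : Type} (l₁ l₀ : Λ) (c : Test) (hc : c.bound ≤ R)
    (s : Mem O) : TM2.stepAux (testStmt R l₁ l₀ c) none (Mem.stk R s) =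
      ⟨some (cond (c.holds s) l₁ l₀), none, Mem.stk R s⟩ := by
  cases c with
  | pos r =>
    rw [testStmt, dif_pos (show r < R from hc), stepAux_branchOn]
    simp only [Mem.stk, Test.holds]
    rcases s.reg r <;> simp [List.replicate_succ]
  | inpNonempty => rw [testStmt, stepAux_branchOn]; rfl
  | auxNonempty => rw [testStmt, stepAux_branchOn]; rfl
  | inpTrue => rw [testStmt, stepAux_branchOn]; rfl

/-- The machine configuration at address `a`. -/
def cfgAt (R : ℕ) (code : List (Instr O)) (a : ℕ) (s : Mem O) :
    TM2.Cfg (Stk.Alphabet O (R := R)) (Fin (code.length + 1)) (Option Bool) :=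
  ⟨some (Fin.ofNat _ a), none, Mem.stk R s⟩

theorem getElem?_ofNat {code : List (Instr O)} {a : ℕ} {i : Instr O} (h : code[a]? = some i) :
    code[((Fin.ofNat (code.length + 1) a : Fin (code.length + 1)) : ℕ)]? = some i ∧
    ((Fin.ofNat (code.length + 1) a : Fin (code.length + 1)) : ℕ) = a := by
  have ha : a < code.length := by
    by_contra hn
    rw [List.getElem?_eq_none (by omega)] at h
    cases h
  have : ((Fin.ofNat (code.length + 1) a : Fin (code.length + 1)) : ℕ) = a :=
    Nat.mod_eq_of_lt (by omega)
  rw [this]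
  exact ⟨h, rfl⟩

theorem step_op {R : ℕ} {code : List (Instr O)} {a : ℕ} {i : Op O} (h : code[a]? = some (.op i))
    (hi : i.bound ≤ R) (s : Mem O) :
    TM2.step (machine R code) (cfgAt R code a s) = some (cfgAt R code (a + 1) (i.run s)) := by
  obtain ⟨h1, h2⟩ := getElem?_ofNat h
  rw [cfgAt, TM2.step, machine, h1]
  simp only [h2]
  rw [stepAux_opStmt _ _ hi]
  rfl

theorem step_jumpUnless {R : ℕ} {code : List (Instr O)} {a b : ℕ} {c : Test}
    (h : code[a]? = some (.jumpUnless c b)) (hc : c.bound ≤ R) (s : Mem O) :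
    TM2.step (machine R code) (cfgAt R code a s) =
      some (cfgAt R code (cond (c.holds s) (a + 1) b) s) := by
  obtain ⟨h1, h2⟩ := getElem?_ofNat h
  rw [cfgAt, TM2.step, machine, h1]
  simp only [h2]
  rw [stepAux_testStmt _ _ _ hc]
  rcases c.holds s <;> rfl

theorem step_jump {R : ℕ} {code : List (Instr O)} {a b : ℕ} (h : code[a]? = some (.jump b))
    (s : Mem O) :
    TM2.step (machine R code) (cfgAt R code a s) = some (cfgAt R code b s) := by
  obtain ⟨h1, h2⟩ := getElem?_ofNat h
  rw [cfgAt, TM2.step, machine, h1]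
  rfl

theorem iterate_bind_add {α : Type} {f : α → Option α} {a b : α} {c : Option α} {m n : ℕ}
    (h₁ : (flip bind f)^[m] (some a) = some b) (h₂ : (flip bind f)^[n] (some b) = c) :
    (flip bind f)^[m + n] (some a) = c := by
  rw [add_comm, Function.iterate_add_apply, h₁, h₂]

/-- The costs in `Exec` are exact: a loop pays one step for each test and one for each jump back.
The code of `p` may sit anywhere inside `code`, which allows induction over the execution. -/
theorem Exec.machine {R : ℕ} {code : List (Instr O)} {p : Prog O} {s s' : Mem O} {n : ℕ}
    (h : Exec p s n s') : ∀ {a : ℕ}, p.bound ≤ R →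
      (∀ i, i < p.size → code[a + i]? = (p.compile a)[i]?) →
      (flip bind (TM2.step (machine R code)))^[n] (some (cfgAt R code a s)) =
        some (cfgAt R code (a + p.size) s') := by
  induction h with
  | op i s =>
    intro a hb hcode
    exact step_op (hcode 0 (by simp [size])) hb s
  | @seq p q s s' s'' m n _ _ ihp ihq =>
    intro a hb hcode
    simp only [bound, max_le_iff] at hb
    refine iterate_bind_add (ihp hb.1 fun i hi => ?_) ?_
    · rw [hcode i (by simp only [size]; omega), compile,
        List.getElem?_append_left (by rw [length_compile]; exact hi)]
    · have := ihq (a := a + p.size) hb.2 fun i hi => ?_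
      · rw [this, size, add_assoc]
      · rw [add_assoc, hcode (p.size + i) (by simp only [size]; omega), compile,
          List.getElem?_append_right (by rw [length_compile]; omega), length_compile,
          Nat.add_sub_cancel_left]
  | @loop_done c p s hc =>
    intro a hb hcode
    simp only [bound, max_le_iff] at hb
    have := step_jumpUnless (hcode 0 (by simp [size])) hb.1 s
    rw [hc] at this
    exact this
  | @loop_next c p s s' s'' m n hc _ _ ihp ihl =>
    intro a hb hcode
    have hb' := hb
    simp only [bound, max_le_iff] at hb'
    have h1 := step_jumpUnless (hcode 0 (by simp [size])) hb'.1 s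
    rw [hc] at h1
    have h2 := ihp (a := a + 1) hb'.2 fun i hi => by
      rw [add_assoc, add_comm 1 i, hcode (i + 1) (by simp only [size]; omega), compile,
        List.getElem?_cons_succ, List.getElem?_append_left (by rw [length_compile]; exact hi)]
    have h3 : TM2.step (Prog.machine R code) (cfgAt R code (a + 1 + p.size) s') =
        some (cfgAt R code a s') := by
      refine step_jump ?_ s'
      rw [add_assoc, add_comm 1, hcode (p.size + 1) (by simp only [size]; omega), compile,
        List.getElem?_cons_succ, List.getElem?_append_right (by rw [length_compile]),
        length_compile]
      simp
    exact iterate_bind_add (iterate_bind_add (iterate_bind_add (m := 1) h1 h2) (n := 1) h3)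
      (ihl hb hcode)
  | @when_skip c p s hc =>
    intro a hb hcode
    simp only [bound, max_le_iff] at hb
    have := step_jumpUnless (hcode 0 (by simp [size])) hb.1 s
    rw [hc] at this
    exact this
  | @when_next c p s s' m hc _ ihp =>
    intro a hb hcode
    simp only [bound, max_le_iff] at hb
    have h1 := step_jumpUnless (hcode 0 (by simp [size])) hb.1 s
    rw [hc] at h1
    have h2 := ihp (a := a + 1) hb.2 fun i hi => by
      rw [add_assoc, add_comm 1 i, hcode (i + 1) (by simp only [size]; omega), compile,
        List.getElem?_cons_succ]
    rw [size, add_comm p.size 1, ← add_assoc]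
    exact iterate_bind_add (m := 1) h1 h2

/-- The bundled machine that executes a program. -/
def toFinTM2 (p : Prog O) : FinTM2 where
  K := Stk p.bound
  k₀ := .inp
  k₁ := .out
  Γ := Stk.Alphabet O
  Λ := Fin ((p.compile 0).length + 1)
  main := Fin.ofNat _ 0
  σ := Option Bool
  initialState := none
  Γk₀Fin := inferInstanceAs (Fintype Bool)
  m := machine p.bound (p.compile 0)

/-- A function that is computed by a program in polynomially many steps is computable in
polynomial time. -/
theorem polyTime_of_exec (p : Prog O) {β : Type} (enc : β → List O) (r : List Bool → β)
    (t : Polynomial ℕ) (h : ∀ x, ∃ n ≤ t.eval x.length,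
      Exec p ⟨fun _ => 0, x, [], []⟩ n ⟨fun _ => 0, [], [], enc (r x)⟩) :
    Nonempty (TM2ComputableInPolyTime id enc r) := by
  choose n hn hexec using h
  -- The additional step is the `halt` at the address behind the last instruction.
  refine ⟨⟨⟨p.toFinTM2, Equiv.refl _, Equiv.refl _⟩, t + 1, fun x => ⟨⟨n x + 1, ?_⟩, ?_⟩⟩⟩
  · have h1 := (hexec x).machine (R := p.bound) (code := p.compile 0) (a := 0) le_rfl
      (fun i hi => by rw [zero_add])
    have h2 : TM2.step (machine p.bound (p.compile 0)) (cfgAt p.bound (p.compile 0) (0 + p.size)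
        ⟨fun _ => 0, [], [], enc (r x)⟩) =
          some (haltList p.toFinTM2 (enc (r x))) := by
      have hend : ((Fin.ofNat ((p.compile 0).length + 1) (0 + p.size) :
          Fin ((p.compile 0).length + 1)) : ℕ) = (p.compile 0).length := by
        rw [zero_add, length_compile]
        exact Nat.mod_eq_of_lt (by omega)
      rw [cfgAt, TM2.step, machine, hend, List.getElem?_eq_none le_rfl]
      exact congrArg (fun S => some (⟨none, none, S⟩ : TM2.Cfg (Stk.Alphabet O (R := p.bound))
        (Fin ((p.compile 0).length + 1)) (Option Bool))) (funext fun k => by cases k <;> rfl)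
    have h0 : initList p.toFinTM2 x =
        cfgAt p.bound (p.compile 0) 0 ⟨fun _ => 0, x, [], []⟩ :=
      congrArg (fun S => (⟨some (Fin.ofNat _ 0), none, S⟩ : TM2.Cfg (Stk.Alphabet O (R := p.bound))
        (Fin ((p.compile 0).length + 1)) (Option Bool))) (funext fun k => by cases k <;> rfl)
    have := iterate_bind_add h1 (n := 1) h2
    rw [← h0] at this
    have hid : ∀ {α : Type} (l : List α), List.map (Equiv.refl α).invFun l = l :=
      fun l => List.map_id l
    exact (congrArg (fun l => (flip bind p.toFinTM2.step)^[n x + 1]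
      (some (initList p.toFinTM2 l))) (hid x)).trans
        (this.trans (congrArg (fun l => some (haltList p.toFinTM2 l)) (hid _).symm))
  · simpa using hn x

end Prog

/-! ### Numbers and words that programs can produce -/

namespace Prog

variable {O : Type}

theorem Exec.congr {p : Prog O} {ρ ρ' τ τ' : ℕ → ℕ} {x x' y y' : List Bool} {w w' : List O} {n : ℕ}
    (h : Exec p ⟨ρ, x, y, w⟩ n ⟨ρ', x', y', w'⟩) (hρ : ∀ r, ρ r = τ r) (hρ' : ∀ r, ρ' r = τ' r) :
    Exec p ⟨τ, x, y, w⟩ n ⟨τ', x', y', w'⟩ := by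
  obtain rfl : ρ = τ := funext hρ
  obtain rfl : ρ' = τ' := funext hρ'
  exact h

/-- Repeat `p` as often as register `r` says; the register counts down. -/
def repeatReg (r : ℕ) (p : Prog O) : Prog O := loop (.pos r) (seq (op (.dec r)) p)

/-- `S i` is the memory with `i` rounds left. A round costs the body plus three steps: the test, the
decrement and the jump back. -/
theorem exec_repeatReg {r N B : ℕ} {p : Prog O} {S : ℕ → Mem O} (hr : ∀ i ≤ N, (S i).reg r = i)
    (hp : ∀ i < N, ∃ n ≤ B, Exec p ((Op.dec r).run (S (i + 1))) n (S i)) :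
    ∃ n ≤ N * (B + 3) + 1, Exec (repeatReg r p) (S N) n (S 0) := by
  induction N with
  | zero => exact ⟨1, by omega, .loop_done _ (by simp [Test.holds, hr 0 le_rfl])⟩
  | succ N ih =>
    obtain ⟨n, hn, h⟩ := ih (fun i hi => hr i (by omega)) fun i hi => hp i (by omega)
    obtain ⟨n', hn', h'⟩ := hp N (by omega)
    refine ⟨1 + (1 + n') + 1 + n, ?_, .loop_next ?_ (.seq (.op _ _) h') h⟩
    · rw [add_mul, one_mul]; omega
    · simp [Test.holds, hr (N + 1) le_rfl]

/-- Move the auxiliary stack back to the input. -/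
def restore : Prog O := loop .auxNonempty (op .auxToInp)

theorem exec_restore (ρ : ℕ → ℕ) (y x : List Bool) (w : List O) :
    Exec restore ⟨ρ, x, y, w⟩ (y.length * 3 + 1) ⟨ρ, y.reverse ++ x, [], w⟩ := by
  induction y generalizing x with
  | nil => exact .loop_done _ rfl
  | cons b y ih =>
    have := Exec.loop_next (c := .auxNonempty) (s := ⟨ρ, x, b :: y, w⟩) rfl (.op .auxToInp _)
      (ih (b :: x))
    rw [List.length_cons, List.reverse_cons, List.append_assoc, List.singleton_append,
      show (y.length + 1) * 3 + 1 = 1 + 1 + 1 + (y.length * 3 + 1) by omega]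
    exact this

end Prog

open Prog

/-- The values of the first `d` registers. -/
def firstRegs (d : ℕ) (ρ : ℕ → ℕ) : Fin d → ℕ := fun i => ρ i

theorem firstRegs_update {d D : ℕ} (h : d ≤ D) (ρ : ℕ → ℕ) (a : ℕ) :
    firstRegs d (Function.update ρ D a) = firstRegs d ρ := by
  funext i
  rw [firstRegs, firstRegs, Function.update_of_ne (by omega)]

/-- A number, depending on the input and on `d` parameters, that is computed in polynomial time by
a program: with the parameters in the first `d` registers, the program `p D T` adds the number to
register `D` and uses the registers from `T` on for intermediate results. -/
def Evaluable (O : Type) (d : ℕ) (E : List Bool → (Fin d → ℕ) → ℕ) : Prop :=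
  ∃ (p : ℕ → ℕ → Prog O) (c : Polynomial ℕ), ∀ (x : List Bool) (ρ : ℕ → ℕ) (m D T : ℕ),
    (∀ i < d, ρ i ≤ m) → x.length ≤ m → d ≤ D → D < T → (∀ r, T ≤ r → ρ r = 0) →
      E x (firstRegs d ρ) ≤ c.eval m ∧ ∀ w, ∃ n ≤ c.eval m, Exec (p D T) ⟨ρ, x, [], w⟩ n
        ⟨Function.update ρ D (ρ D + E x (firstRegs d ρ)), x, [], w⟩

namespace Evaluable

variable {O : Type} {d : ℕ} {E E' : List Bool → (Fin d → ℕ) → ℕ}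

/-- Decrementing the zero register `T` serves as the idle instruction. -/
theorem zero : Evaluable O d fun _ _ => 0 := by
  refine ⟨fun D T => op (.dec T), 1, fun x ρ m D T _ _ _ _ hT => ⟨by simp, fun w =>
    ⟨1, by simp, ?_⟩⟩⟩
  refine (Exec.op (.dec T) (⟨ρ, x, [], w⟩ : Mem O)).congr (fun _ => rfl) fun r => ?_
  have := hT T le_rfl
  simp only [Function.update_apply]
  split_ifs <;> simp_all

theorem one : Evaluable O d fun _ _ => 1 := by
  refine ⟨fun D T => op (.inc D), 1, fun x ρ m D T _ _ _ _ hT => ⟨by simp, fun w =>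
    ⟨1, by simp, .op (.inc D) _⟩⟩⟩

theorem add (h : Evaluable O d E) (h' : Evaluable O d E') :
    Evaluable O d fun x v => E x v + E' x v := by
  obtain ⟨p, c, h⟩ := h
  obtain ⟨p', c', h'⟩ := h'
  refine ⟨fun D T => seq (p D T) (p' D T), c + c', fun x ρ m D T hm hx hD hDT hT => ?_⟩
  obtain ⟨hle, h⟩ := h x ρ m D T hm hx hD hDT hT
  obtain ⟨hle', h'⟩ := h' x (Function.update ρ D (ρ D + E x (firstRegs d ρ))) m D T
    (fun i hi => by rw [Function.update_of_ne (by omega)]; exact hm i hi) hx hD hDT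
    (fun r hr => by rw [Function.update_of_ne (by omega)]; exact hT r hr)
  rw [firstRegs_update hD] at hle' h'
  rw [Polynomial.eval_add]
  refine ⟨Nat.add_le_add hle hle', fun w => ?_⟩
  obtain ⟨n, hn, h⟩ := h w
  obtain ⟨n', hn', h'⟩ := h' w
  refine ⟨n + n', by omega, ?_⟩
  have := Exec.seq h h'
  rwa [Function.update_idem, Function.update_self, add_assoc] at this

theorem const (a : ℕ) : Evaluable O d fun _ _ => a := by
  induction a with
  | zero => exact zero
  | succ a ih => exact ih.add one

/-- Reading a register by counting down destroys it; a second copy is made in `T` and moved back. -/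
theorem var (i : Fin d) : Evaluable O d fun _ v => v i := by
  refine ⟨fun D T => seq (repeatReg i (seq (op (.inc D)) (op (.inc T))))
    (repeatReg T (op (.inc i))), 9 * .X + 2, fun x ρ m D T hm hx hD hDT hT => ?_⟩
  have hi := hm i i.2
  have hiD : (i : ℕ) ≠ D := by omega
  have hiT : (i : ℕ) ≠ T := by omega
  have hTT := hT T le_rfl
  simp only [Polynomial.eval_add, Polynomial.eval_mul, Polynomial.eval_X, Polynomial.eval_ofNat,
    firstRegs]
  refine ⟨by omega, fun w => ?_⟩
  obtain ⟨n, hn, h⟩ := exec_repeatReg (r := i) (N := ρ i) (B := 2) (O := O)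
    (p := seq (op (.inc D)) (op (.inc T)))
    (S := fun j => ⟨Function.update (Function.update (Function.update ρ i j) D
      (ρ D + (ρ i - j))) T (ρ i - j), x, [], w⟩)
    (fun j _ => by simp [hiD, hiT])
    (fun j hj => ⟨1 + 1, le_rfl, (Exec.seq (Exec.op _ _) (Exec.op _ _)).congr (fun _ => rfl)
      fun r => by
        simp only [Op.run, Function.update_apply]
        split_ifs <;> omega⟩)
  obtain ⟨n', hn', h'⟩ := exec_repeatReg (r := T) (N := ρ i) (B := 1) (O := O)
    (p := op (.inc i))
    (S := fun j => ⟨Function.update (Function.update (Function.update ρ i (ρ i - j)) D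
      (ρ D + ρ i)) T j, x, [], w⟩)
    (fun j _ => by simp)
    (fun j hj => ⟨1, le_rfl, (Exec.op _ _).congr (fun _ => rfl) fun r => by
      simp only [Function.update_apply]
      split_ifs <;> omega⟩)
  refine ⟨n + n', by omega, Exec.seq
    (h.congr (τ' := Function.update (Function.update (Function.update ρ i 0) D
      (ρ D + ρ i)) T (ρ i)) (fun r => ?_) fun r => ?_) (h'.congr (fun r => ?_) fun r => ?_)⟩
  all_goals
    simp only [Function.update_apply]
    split_ifs <;> simp_all

theorem mul (h : Evaluable O d E) (h' : Evaluable O d E') :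
    Evaluable O d fun x v => E x v * E' x v := by
  obtain ⟨p, c, h⟩ := h
  obtain ⟨p', c', h'⟩ := h'
  -- Register `T` holds the first factor, which counts the rounds; its polynomial bound is why
  -- `Evaluable` bounds values as well as running times.
  refine ⟨fun D T => seq (p T (T + 1)) (repeatReg T (p' D (T + 1))),
    c * c' + c + (c * (c' + 3) + 1), fun x ρ m D T hm hx hD hDT hT => ?_⟩
  obtain ⟨hle, h⟩ := h x ρ m T (T + 1) hm hx (by omega) (by omega) fun r hr => hT r (by omega)
  have hupd : ∀ a b, firstRegs d (Function.update (Function.update ρ D a) T b) = firstRegs d ρ :=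
    fun a b => by rw [firstRegs_update (by omega), firstRegs_update hD]
  have h'' : ∀ a b, _ := fun a b => h' x (Function.update (Function.update ρ D a) T b) m D (T + 1)
    (fun i hi => by
      rw [Function.update_of_ne (by omega), Function.update_of_ne (by omega)]; exact hm i hi)
    hx hD (by omega)
    (fun r hr => by
      rw [Function.update_of_ne (by omega), Function.update_of_ne (by omega)]; exact hT r (by omega))
  simp only [hupd] at h''
  have hle' := (h'' 0 0).1
  simp only [Polynomial.eval_add, Polynomial.eval_mul, Polynomial.eval_one, Polynomial.eval_ofNat]
  refine ⟨?_, fun w => ?_⟩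
  · have := Nat.mul_le_mul hle hle'
    omega
  obtain ⟨n, hn, h⟩ := h w
  obtain ⟨n', hn', hrep⟩ := exec_repeatReg (r := T) (N := E x (firstRegs d ρ))
    (B := c'.eval m) (O := O) (p := p' D (T + 1))
    (S := fun j => ⟨Function.update (Function.update ρ D
      (ρ D + (E x (firstRegs d ρ) - j) * E' x (firstRegs d ρ))) T j, x, [], w⟩)
    (fun j _ => by simp)
    (fun j hj => by
      obtain ⟨n, hn, h⟩ := (h'' (ρ D + (E x (firstRegs d ρ) - (j + 1)) * E' x (firstRegs d ρ)) j).2 w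
      refine ⟨n, hn, h.congr (fun r => ?_) fun r => ?_⟩
      · simp
      · have : (E x (firstRegs d ρ) - j) * E' x (firstRegs d ρ) =
            (E x (firstRegs d ρ) - (j + 1)) * E' x (firstRegs d ρ) + E' x (firstRegs d ρ) := by
          rw [← Nat.succ_mul]; congr 1; omega
        simp only [Function.update_apply, this]
        split_ifs <;> omega)
  refine ⟨n + n', ?_, ?_⟩
  · have := Nat.mul_le_mul_right (c'.eval m + 3) hle
    omega
  · have hT0 := hT T le_rfl
    refine Exec.seq h (hrep.congr (fun r => ?_) fun r => ?_)
    all_goals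
      simp only [Function.update_apply]
      split_ifs <;> simp_all

theorem sub (h : Evaluable O d E) (h' : Evaluable O d E') :
    Evaluable O d fun x v => E x v - E' x v := by
  obtain ⟨p, c, h⟩ := h
  obtain ⟨p', c', h'⟩ := h'
  refine ⟨fun D T => seq (seq (p T (T + 1)) (p' (T + 1) (T + 2)))
      (seq (repeatReg (T + 1) (op (.dec T))) (repeatReg T (op (.inc D)))),
    c + c' + (c' * 4 + 1) + (c * 4 + 1), fun x ρ m D T hm hx hD hDT hT => ?_⟩
  obtain ⟨hle, h⟩ := h x ρ m T (T + 1) hm hx (by omega) (by omega) fun r hr => hT r (by omega)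
  obtain ⟨hle', h'⟩ := h' x (Function.update ρ T (ρ T + E x (firstRegs d ρ))) m (T + 1) (T + 2)
    (fun i hi => by rw [Function.update_of_ne (by omega)]; exact hm i hi) hx (by omega) (by omega)
    (fun r hr => by rw [Function.update_of_ne (by omega)]; exact hT r (by omega))
  rw [firstRegs_update (by omega)] at hle' h'
  simp only [Polynomial.eval_add, Polynomial.eval_mul, Polynomial.eval_one, Polynomial.eval_ofNat]
  refine ⟨by omega, fun w => ?_⟩
  obtain ⟨n, hn, h⟩ := h w
  obtain ⟨n', hn', h'⟩ := h' w
  have hT0 := hT T le_rfl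
  have hT1 := hT (T + 1) (by omega)
  generalize E x (firstRegs d ρ) = a at *
  generalize E' x (firstRegs d ρ) = b at *
  obtain ⟨n₁, hn₁, h₁⟩ := exec_repeatReg (r := T + 1) (N := b) (B := 1) (O := O)
    (p := op (.dec T))
    (S := fun j => ⟨Function.update (Function.update ρ T (a - (b - j))) (T + 1) j, x, [], w⟩)
    (fun j _ => by simp)
    (fun j hj => ⟨1, le_rfl, (Exec.op _ _).congr (fun _ => rfl) fun r => by
      simp only [Function.update_apply]
      split_ifs <;> omega⟩)
  obtain ⟨n₂, hn₂, h₂⟩ := exec_repeatReg (r := T) (N := a - b) (B := 1) (O := O)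
    (p := op (.inc D))
    (S := fun j => ⟨Function.update (Function.update ρ D (ρ D + (a - b - j))) T j, x, [], w⟩)
    (fun j _ => by simp)
    (fun j hj => ⟨1, le_rfl, (Exec.op _ _).congr (fun _ => rfl) fun r => by
      simp only [Function.update_apply]
      split_ifs <;> omega⟩)
  refine ⟨n + n' + (n₁ + n₂), ?_, ?_⟩
  · have := Nat.sub_le a b
    omega
  · refine Exec.seq (Exec.seq h h') (Exec.seq (h₁.congr (τ' := Function.update ρ T (a - b))
      (fun r => ?_) fun r => ?_) (h₂.congr (fun r => ?_) fun r => ?_))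
    all_goals
      simp only [Function.update_apply]
      split_ifs <;> simp_all

end Evaluable

namespace Prog

variable {O : Type}

theorem Exec.of_eq {p : Prog O} {s s' t t' : Mem O} {n : ℕ} (h : Exec p s n s') (hs : s = t)
    (hs' : s' = t') : Exec p t n t' := hs ▸ hs' ▸ h

/-- Add the length of the input to register `D`, moving the input to the auxiliary stack. -/
def count (D : ℕ) : Prog O := loop .inpNonempty (seq (op .inpToAux) (op (.inc D)))

theorem exec_count (D : ℕ) (ρ : ℕ → ℕ) (x y : List Bool) (w : List O) :
    Exec (count D) ⟨ρ, x, y, w⟩ (x.length * 4 + 1)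
      ⟨Function.update ρ D (ρ D + x.length), [], x.reverse ++ y, w⟩ := by
  induction x generalizing ρ y with
  | nil =>
    exact Exec.of_eq (p := count D) (Exec.loop_done (c := .inpNonempty) _ rfl) rfl (by simp)
  | cons b x ih =>
    have := Exec.loop_next (c := .inpNonempty) (s := ⟨ρ, b :: x, y, w⟩) rfl
      (.seq (.op .inpToAux _) (.op (.inc D) _)) (ih (Function.update ρ D (ρ D + 1)) (b :: y))
    rw [List.length_cons, List.reverse_cons, List.append_assoc, List.singleton_append,
      show (x.length + 1) * 4 + 1 = 1 + (1 + 1) + 1 + (x.length * 4 + 1) by omega]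
    refine this.congr (fun _ => rfl) fun r => ?_
    simp only [Function.update_apply]
    split_ifs <;> omega

end Prog

open Prog

namespace Evaluable

variable {O : Type} {d : ℕ} {E E' : List Bool → (Fin d → ℕ) → ℕ}

theorem length : Evaluable O d fun x _ => x.length := by
  refine ⟨fun D T => seq (count D) restore, 7 * .X + 2, fun x ρ m D T hm hx hD hDT hT => ?_⟩
  simp only [Polynomial.eval_add, Polynomial.eval_mul, Polynomial.eval_X, Polynomial.eval_ofNat]
  refine ⟨by omega, fun w => ⟨_, ?_, (Exec.seq (exec_count D ρ x [] w)
    (exec_restore _ _ _ _)).of_eq rfl (by simp)⟩⟩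
  simp only [List.append_nil, List.length_reverse]
  omega

/-- The digit of the input at a given position. -/
theorem digit (h : Evaluable O d E) :
    Evaluable O d fun x v => (x[E x v]? == some true).toNat := by
  obtain ⟨p, c, h⟩ := h
  refine ⟨fun D T => seq (p T (T + 1)) (seq (repeatReg T (op .inpToAux))
      (seq (when .inpTrue (op (.inc D))) restore)),
    c + (c * 4 + 1) + 3 + (3 * .X + 1), fun x ρ m D T hm hx hD hDT hT => ?_⟩
  obtain ⟨hle, h⟩ := h x ρ m T (T + 1) hm hx (by omega) (by omega) fun r hr => hT r (by omega)
  have hT0 := hT T le_rfl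
  simp only [Polynomial.eval_add, Polynomial.eval_mul, Polynomial.eval_one, Polynomial.eval_ofNat,
    Polynomial.eval_X]
  refine ⟨(Bool.toNat_le _).trans (by omega), fun w => ?_⟩
  obtain ⟨n, hn, h⟩ := h w
  generalize E x (firstRegs d ρ) = N at *
  -- Beyond the end of the input the instruction does nothing, so positions outside the word yield
  -- digit 0.
  obtain ⟨n₁, hn₁, h₁⟩ := exec_repeatReg (r := T) (N := N) (B := 1) (O := O)
    (p := op .inpToAux)
    (S := fun j => ⟨Function.update ρ T j, x.drop (N - j), (x.take (N - j)).reverse, w⟩)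
    (fun j _ => by simp)
    (fun j hj => ⟨1, le_rfl, (Exec.op _ _).of_eq rfl (by
      have hj' : N - j = N - (j + 1) + 1 := by omega
      simp only [Op.run, hj', List.take_add_one, List.reverse_append, List.tail_drop,
        List.head?_drop, Function.update_idem]
      rcases x[N - (j + 1)]? <;> simp)⟩)
  have hmid : ∃ n₂ ≤ 3, Exec (when .inpTrue (op (.inc D)))
      ⟨ρ, x.drop N, (x.take N).reverse, w⟩ n₂
      ⟨Function.update ρ D (ρ D + (x[N]? == some true).toNat), x.drop N, (x.take N).reverse, w⟩ := by
    have hd : Test.inpTrue.holds (⟨ρ, x.drop N, (x.take N).reverse, w⟩ : Mem O) =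
        (x[N]? == some true) := by simp [Test.holds]
    rcases hb : (x[N]? == some true) with _ | _
    · exact ⟨1, by omega, (Exec.when_skip _ (hd.trans hb)).of_eq rfl (by simp)⟩
    · exact ⟨1 + 1, by omega, Exec.when_next (hd.trans hb) (.op _ _)⟩
  obtain ⟨n₂, hn₂, h₂⟩ := hmid
  refine ⟨n + (n₁ + (n₂ + ((x.take N).reverse.length * 3 + 1))), ?_,
    Exec.seq h (Exec.seq (h₁.of_eq ?_ ?_) (Exec.seq h₂ ((exec_restore _ _ _ _).of_eq rfl ?_)))⟩
  · have : (x.take N).reverse.length ≤ m := by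
      rw [List.length_reverse, List.length_take]; omega
    omega
  · simp [hT0]
  · have : Function.update ρ T 0 = ρ := by rw [← hT0, Function.update_eq_self]
    simp [this]
  · simp

theorem weaken (h : Evaluable O d E) : Evaluable O (d + 1) fun x v => E x (Fin.init v) := by
  obtain ⟨p, c, h⟩ := h
  exact ⟨p, c, fun x ρ m D T hm hx hD hDT hT =>
    h x ρ m D T (fun i hi => hm i (by omega)) hx (by omega) hDT hT⟩

theorem congr (h : Evaluable O d E) (he : ∀ x v, E x v = E' x v) : Evaluable O d E' := by
  obtain rfl : E = E' := funext fun x => funext fun v => he x v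
  exact h

theorem polynomial (p : Polynomial ℕ) : Evaluable O d fun x _ => p.eval x.length := by
  induction p using Polynomial.induction_on with
  | C a => simpa using const a
  | add p q hp hq => simpa using hp.add hq
  | monomial n a h =>
    refine (h.mul length).congr fun x v => ?_
    simp [pow_succ, mul_assoc]

theorem min (h : Evaluable O d E) (h' : Evaluable O d E') :
    Evaluable O d fun x v => min (E x v) (E' x v) :=
  (h'.sub (h'.sub h)).congr fun x v => by omega

/-- The truth value of `E = 0`. -/
theorem eqZero (h : Evaluable O d E) : Evaluable O d fun x v => (decide (E x v = 0)).toNat :=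
  ((const 1).sub h).congr fun x v => by
    rcases Nat.eq_zero_or_pos (E x v) with h | h
    · simp [h]
    · rw [decide_eq_false (by omega)]; simp; omega

end Evaluable

/-! ### Words written in polynomial time. -/

/-- A word, depending on the input and on `d` parameters, that is written in polynomial time by a
program that finds the parameters in the first `d` registers. -/
def Writable {O : Type} (d : ℕ) (G : List Bool → (Fin d → ℕ) → List O) : Prop :=
  ∃ (p : Prog O) (c : Polynomial ℕ), ∀ (x : List Bool) (ρ : ℕ → ℕ) (m : ℕ),
    (∀ i < d, ρ i ≤ m) → x.length ≤ m → (∀ r, d ≤ r → ρ r = 0) →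
      ∀ w, ∃ n ≤ c.eval m, Exec p ⟨ρ, x, [], w⟩ n ⟨ρ, x, [], G x (firstRegs d ρ) ++ w⟩

namespace Writable

variable {O : Type} {d : ℕ} {G G' : List Bool → (Fin d → ℕ) → List O}

theorem congr (h : Writable d G) (he : ∀ x v, G x v = G' x v) : Writable d G' := by
  obtain rfl : G = G' := funext fun x => funext fun v => he x v
  exact h

theorem nil : Writable (O := O) d fun _ _ => [] := by
  refine ⟨op (.dec d), 1, fun x ρ m _ _ hρ w => ⟨1, by simp, ?_⟩⟩
  refine (Exec.op _ _).congr (fun _ => rfl) fun r => ?_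
  have := hρ d le_rfl
  simp only [Function.update_apply]
  split_ifs <;> simp_all

theorem append (h : Writable d G) (h' : Writable d G') :
    Writable d fun x v => G x v ++ G' x v := by
  obtain ⟨p, c, h⟩ := h
  obtain ⟨p', c', h'⟩ := h'
  -- Output is pushed onto a stack, so the right part is written first.
  refine ⟨seq p' p, c' + c, fun x ρ m hm hx hρ w => ?_⟩
  obtain ⟨n', hn', h'⟩ := h' x ρ m hm hx hρ w
  obtain ⟨n, hn, h⟩ := h x ρ m hm hx hρ (G' x (firstRegs d ρ) ++ w)
  refine ⟨n' + n, ?_, (Exec.seq h' h).of_eq rfl (by simp)⟩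
  rw [Polynomial.eval_add]
  omega

theorem word (u : List O) : Writable d fun _ _ => u := by
  induction u with
  | nil => exact nil
  | cons a u ih =>
    have ha : Writable d fun _ _ => [a] :=
      ⟨op (.emit a), 1, fun x ρ m _ _ _ w => ⟨1, by simp, .op (.emit a) _⟩⟩
    exact ha.append ih

theorem loop {E : List Bool → (Fin d → ℕ) → ℕ} {G : List Bool → (Fin d → ℕ) → ℕ → List O}
    (hE : Evaluable O d E)
    (hG : Writable (d + 1) fun x v => G x (Fin.init v) (v (Fin.last d))) :
    Writable d fun x v => (List.range (E x v)).flatMap (G x v) := by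
  obtain ⟨p, c, hE⟩ := hE
  obtain ⟨p', c', hG⟩ := hG
  -- The loop index becomes parameter `d` of the body. It is below `c.eval m`, so `m + c.eval m`
  -- bounds all parameters there.
  refine ⟨seq (p d (d + 1)) (repeatReg d p'), c + (c * (c'.comp (.X + c) + 3) + 1),
    fun x ρ m hm hx hρ w => ?_⟩
  obtain ⟨hle, hE⟩ := hE x ρ m d (d + 1) hm hx le_rfl (by omega) fun r hr => hρ r (by omega)
  obtain ⟨n, hn, hE⟩ := hE w
  set N := E x (firstRegs d ρ) with hN
  have hG' : ∀ j < N, ∀ w', ∃ n ≤ c'.eval (m + c.eval m),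
      Exec p' ⟨Function.update ρ d j, x, [], w'⟩ n
        ⟨Function.update ρ d j, x, [], G x (firstRegs d ρ) j ++ w'⟩ := by
    intro j hj w'
    obtain ⟨n, hn, h⟩ := hG x (Function.update ρ d j) (m + c.eval m)
      (fun i hi => by
        rw [Function.update_apply]
        split_ifs with hid
        · omega
        · exact (hm i (by omega)).trans (by omega))
      (by omega)
      (fun r hr => by rw [Function.update_of_ne (by omega)]; exact hρ r (by omega)) w'
    have h1 : Fin.init (firstRegs (d + 1) (Function.update ρ d j)) = firstRegs d ρ :=
      firstRegs_update le_rfl ρ j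
    have h2 : firstRegs (d + 1) (Function.update ρ d j) (Fin.last d) = j := by
      simp [firstRegs]
    simp only [h1, h2] at h
    exact ⟨n, hn, h⟩
  -- The register counts down, which suits the output: when `j` rounds are left, the words for the
  -- indices from `j` on have been written.
  obtain ⟨n', hn', hrep⟩ := exec_repeatReg (r := d) (N := N) (B := c'.eval (m + c.eval m)) (p := p')
    (S := fun j => ⟨Function.update ρ d j, x, [],
      (List.range' j (N - j)).flatMap (G x (firstRegs d ρ)) ++ w⟩)
    (fun j _ => by simp)
    (fun j hj => by
      obtain ⟨n, hn, h⟩ := hG' j hj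
        ((List.range' (j + 1) (N - (j + 1))).flatMap (G x (firstRegs d ρ)) ++ w)
      refine ⟨n, hn, h.of_eq (by simp [Op.run]) ?_⟩
      rw [show N - j = N - (j + 1) + 1 by omega, List.range'_succ, List.flatMap_cons,
        List.append_assoc])
  have hd := hρ d le_rfl
  refine ⟨n + n', ?_, Exec.seq hE (hrep.of_eq ?_ ?_)⟩
  · simp only [Polynomial.eval_add, Polynomial.eval_mul, Polynomial.eval_one,
      Polynomial.eval_ofNat, Polynomial.eval_comp, Polynomial.eval_X]
    have := Nat.mul_le_mul_right (c'.eval (m + c.eval m) + 3) hle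
    omega
  · simp [hd]
  · have : Function.update ρ d 0 = ρ := by rw [← hd, Function.update_eq_self]
    simp [this, List.range_eq_range', hN]

/-- Words that are repeated. -/
theorem repeatWord {E : List Bool → (Fin d → ℕ) → ℕ} (hE : Evaluable O d E) (u : List O) :
    Writable d fun x v => (List.replicate (E x v) u).flatten :=
  (loop (G := fun _ _ _ => u) hE (word u)).congr fun x v => by
    induction E x v with
    | zero => rfl
    | succ n ih => rw [List.range_succ, List.flatMap_append, ih, List.replicate_succ']; simp

/-- A function whose values are writable words is computable in polynomial time. -/
theorem polyTime {β : Type} {enc : β → List O} {r : List Bool → β}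
    (h : Writable 0 fun x _ => enc (r x)) :
    Nonempty (Turing.TM2ComputableInPolyTime id enc r) := by
  obtain ⟨p, c, h⟩ := h
  have hdrop : ∀ (x : List Bool) (w : List O), Exec (.loop .inpNonempty (op .dropInp))
      ⟨fun _ => 0, x, [], w⟩ (x.length * 3 + 1) ⟨fun _ => 0, [], [], w⟩ := by
    intro x w
    induction x with
    | nil => exact .loop_done _ rfl
    | cons b x ih =>
      have := Exec.loop_next (c := .inpNonempty) (s := ⟨fun _ => 0, b :: x, [], w⟩) rfl
        (.op .dropInp _) ih
      rw [List.length_cons, show (x.length + 1) * 3 + 1 = 1 + 1 + 1 + (x.length * 3 + 1) by omega]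
      exact this
  refine polyTime_of_exec (seq p (.loop .inpNonempty (op .dropInp))) enc r (c + (3 * .X + 1))
    fun x => ?_
  obtain ⟨n, hn, h⟩ := h x (fun _ => 0) x.length (by simp) le_rfl (by simp) []
  refine ⟨n + (x.length * 3 + 1), ?_, Exec.seq h ((hdrop x _).of_eq rfl (by simp))⟩
  simp only [Polynomial.eval_add, Polynomial.eval_mul, Polynomial.eval_one,
    Polynomial.eval_ofNat, Polynomial.eval_X]
  omega

end Writable

/-! ### Writing down formulas -/

theorem Evaluable.cond {O : Type} {d : ℕ} {b : List Bool → (Fin d → ℕ) → Bool}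
    {E E' : List Bool → (Fin d → ℕ) → ℕ} (hb : Evaluable O d fun x v => (b x v).toNat)
    (h : Evaluable O d E) (h' : Evaluable O d E') :
    Evaluable O d fun x v => cond (b x v) (E x v) (E' x v) :=
  ((hb.mul h).add (((const 1).sub hb).mul h')).congr fun x v => by cases b x v <;> simp

namespace CTL

variable {d : ℕ}

/-- A formula, depending on the input and on `d` parameters, that is written in polynomial
time. -/
def WritableFormula (d : ℕ) (F : List Bool → (Fin d → ℕ) → CTL Loc) : Prop :=
  Writable d fun x v => (F x v).encode

/-- A context, depending on the input and on `d` parameters, that puts before a formula a word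
that is written in polynomial time. -/
def WritableContext (d : ℕ) (C : List Bool → (Fin d → ℕ) → CTL Loc → CTL Loc) : Prop :=
  ∃ G : List Bool → (Fin d → ℕ) → List (Token Loc), Writable d G ∧
    ∀ x v φ, (C x v φ).encode = G x v ++ φ.encode

namespace WritableContext

variable {C C' : List Bool → (Fin d → ℕ) → CTL Loc → CTL Loc} {F : List Bool → (Fin d → ℕ) → CTL Loc}

theorem apply (h : WritableContext d C) (hF : WritableFormula d F) :
    WritableFormula d fun x v => C x v (F x v) := by
  obtain ⟨G, hG, h⟩ := h
  exact (hG.append hF).congr fun x v => (h x v _).symm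

theorem comp (h : WritableContext d C) (h' : WritableContext d C') :
    WritableContext d fun x v φ => C x v (C' x v φ) := by
  obtain ⟨G, hG, h⟩ := h
  obtain ⟨G', hG', h'⟩ := h'
  exact ⟨_, hG.append hG', fun x v φ => by rw [h, h', List.append_assoc]⟩

theorem congr (h : WritableContext d C) (hC : ∀ x v φ, C x v φ = C' x v φ) :
    WritableContext d C' := by
  obtain rfl : C = C' := funext fun x => funext fun v => funext fun φ => hC x v φ
  exact h

theorem id : WritableContext d fun _ _ φ => φ :=
  ⟨_, .nil, fun _ _ _ => rfl⟩

theorem neg : WritableContext d fun _ _ φ => neg φ :=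
  ⟨_, .word [.neg], fun _ _ _ => rfl⟩

theorem exX : WritableContext d fun _ _ φ => exX φ :=
  ⟨_, .word [.exX], fun _ _ _ => rfl⟩

theorem conj (hF : WritableFormula d F) : WritableContext d fun x v φ => conj (F x v) φ :=
  ⟨_, (Writable.word [.conj]).append hF, fun _ _ _ => rfl⟩

theorem exU (hF : WritableFormula d F) : WritableContext d fun x v φ => exU (F x v) φ :=
  ⟨_, (Writable.word [.exU]).append hF, fun _ _ _ => rfl⟩

theorem disj (hF : WritableFormula d F) : WritableContext d fun x v φ => disj (F x v) φ :=
  neg.comp ((conj (neg.apply hF)).comp neg)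

theorem ite {F' : List Bool → (Fin d → ℕ) → CTL Loc} (hF : WritableFormula d F)
    (hF' : WritableFormula d F') : WritableContext d fun x v φ => ite (F x v) (F' x v) φ :=
  (disj ((conj hF).apply hF')).comp (conj (neg.apply hF))

/-- Nesting along the numbers below a computed bound. -/
theorem foldrRange {E : List Bool → (Fin d → ℕ) → ℕ}
    {C : List Bool → (Fin d → ℕ) → ℕ → CTL Loc → CTL Loc} (hE : Evaluable (Token Loc) d E)
    (hC : WritableContext (d + 1) fun x v φ => C x (Fin.init v) (v (Fin.last d)) φ) :
    WritableContext d fun x v φ => (List.range (E x v)).foldr (C x v) φ := by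
  obtain ⟨G, hG, h⟩ := hC
  refine ⟨_, Writable.loop (G := fun x v j => G x (Fin.snoc (α := fun _ => ℕ) v j)) hE
    (hG.congr fun x v => by rw [Fin.snoc_init_self]), fun x v φ => ?_⟩
  dsimp only
  induction List.range (E x v) with
  | nil => rfl
  | cons j l ih =>
    have := h x (Fin.snoc (α := fun _ => ℕ) v j) (l.foldr (C x v) φ)
    simp only [Fin.init_snoc, Fin.snoc_last] at this
    rw [List.foldr_cons, this, ih, List.flatMap_cons, List.append_assoc]

/-- Nesting along a fixed list. -/
theorem foldrList {ι : Type} (l : List ι) {C : ι → List Bool → (Fin d → ℕ) → CTL Loc → CTL Loc}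
    (hC : ∀ i, WritableContext d (C i)) :
    WritableContext d fun x v φ => l.foldr (fun i => C i x v) φ := by
  induction l with
  | nil => exact id
  | cons i l ih => exact (hC i).comp ih

end WritableContext

namespace WritableFormula

variable {F F' : List Bool → (Fin d → ℕ) → CTL Loc}

theorem congr (h : WritableFormula d F) (hF : ∀ x v, F x v = F' x v) : WritableFormula d F' := by
  obtain rfl : F = F' := funext fun x => funext fun v => hF x v
  exact h

theorem const (φ : CTL Loc) : WritableFormula d fun _ _ => φ := Writable.word _

theorem iff (h : WritableFormula d F) (h' : WritableFormula d F') :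
    WritableFormula d fun x v => iff (F x v) (F' x v) :=
  (WritableContext.conj (WritableContext.neg.apply
    ((WritableContext.conj h).apply (WritableContext.neg.apply h')))).apply
    (WritableContext.neg.apply ((WritableContext.conj (WritableContext.neg.apply h)).apply h'))

theorem ofBool {b : List Bool → (Fin d → ℕ) → Bool}
    (hb : Evaluable (Token Loc) d fun x v => (b x v).toNat) :
    WritableFormula d fun x v => ofBool (b x v) :=
  ((Writable.repeatWord ((Evaluable.const 1).sub hb) [.neg]).append
    (Writable.word tru.encode)).congr fun x v => by
      dsimp only
      cases b x v <;> rfl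

variable {E E' : List Bool → (Fin d → ℕ) → ℕ}

theorem psi (hE : Evaluable (Token Loc) d E) : WritableFormula d fun x v => psi (E x v) := by
  -- In `walk` the recursive formula sits in the middle, so `psi` is not an iterated prefix; its
  -- encoding is a power of `pre`, the base formula, and the same power of `post`.
  let pre : List (Token Loc) := .exX :: .exU :: .conj ::
    ((disj (disj (atom .q0) (atom .q1)) (disj (atom .q2) (atom .q3))).encode ++
      .exX :: .conj :: (disj (atom .t) (atom .tbar)).encode)
  let post : List (Token Loc) := (conj (atom .q0) (neg (exX tru))).encode
  have key : ∀ j, (CTL.psi j).encode = (List.replicate j pre).flatten ++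
      ((CTL.psi 0).encode ++ (List.replicate j post).flatten) := by
    intro j
    induction j with
    | zero => simp
    | succ j ih =>
      have : (CTL.psi (j + 1)).encode = pre ++ ((CTL.psi j).encode ++ post) := by
        simp [CTL.psi, walk, encode, pre, post]
      rw [this, ih, List.replicate_succ, List.flatten_cons, List.replicate_succ',
        List.flatten_append]
      simp
  exact ((Writable.repeatWord hE pre).append ((Writable.word _).append
    (Writable.repeatWord hE post))).congr fun x v => (key _).symm

theorem bitF (hE : Evaluable (Token Loc) d E) : WritableFormula d fun x v => bitF (E x v) := by
  refine ((WritableContext.exX.comp (.conj (const (CTL.disj (atom .q1) (atom .q2))))).apply ?_)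
  refine Writable.congr (((Writable.word (.exU :: .conj ::
    ((disj (disj (atom .q0) (atom .q1)) (disj (atom .q2) (atom .q3))).encode ++
      .exX :: .conj :: (disj (atom .t) (atom .tbar)).encode))).append (psi hE)).append
    (Writable.word (conj (atom .q0) (neg (exX tru))).encode)) fun x v => ?_
  simp [walk, encode]

end WritableFormula

namespace WritableContext

variable {E E' : List Bool → (Fin d → ℕ) → ℕ}

theorem exQ (hE : Evaluable (Token Loc) d E) :
    WritableContext d fun x v θ => exQ (E x v) θ := by
  have h : ∀ {F : List Bool → (Fin d → ℕ) → CTL Loc}, WritableFormula d F →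
      WritableFormula d fun x v => CTL.conj (atom .p1) (CTL.exX (CTL.conj (atom .tbar) (F x v))) :=
    fun hF => ((conj (.const _)).comp (exX.comp (conj (.const _)))).apply hF
  exact exX.comp ((exU (h (.psi hE))).comp ((conj ((disj (.const (atom .p0))).apply
    (h (neg.apply (.psi hE))))).comp (exX.comp (conj (.const (atom .tbar))))))

theorem allQ (hE : Evaluable (Token Loc) d E) :
    WritableContext d fun x v θ => allQ (E x v) θ :=
  neg.comp ((exQ hE).comp neg)

theorem exBlock (hE : Evaluable (Token Loc) d E) (hE' : Evaluable (Token Loc) d E') :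
    WritableContext d fun x v θ => exBlock (E x v) (E' x v) θ := by
  -- The outermost quantifier has the largest index, while a fold over `List.range` starts at 0;
  -- hence the reversal `t - 1 - o`.
  have key : ∀ m t θ, CTL.exBlock m t θ =
      (List.range t).foldr (fun o φ => CTL.exQ (m + (t - 1 - o)) φ) θ := by
    intro m t θ
    induction t with
    | zero => rfl
    | succ t ih =>
      rw [List.range_succ_eq_map, List.foldr_cons, List.foldr_map, CTL.exBlock, ih]
      simp only [Nat.add_sub_cancel, Nat.sub_zero, Nat.succ_eq_add_one, Nat.sub_add_eq,
        Nat.sub_right_comm t _ 1]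
  refine (foldrRange (C := fun x v o φ => CTL.exQ (E x v + (E' x v - 1 - o)) φ) hE'
    (exQ (hE.weaken.add ((hE'.weaken.sub (.const 1)).sub (.var _))))).congr fun x v φ =>
      (key _ _ _).symm

end WritableContext

/-! ### Writing the reachability formula in polynomial time. -/

section Reachability

variable {s : ℕ} {W k : List Bool → ℕ} {c₀ c₁ : List Bool → ℕ → Fin s}

/-- The cells of a row that depends on the input can be tested in polynomial time. -/
def EvaluableRow (c : List Bool → ℕ → Fin s) : Prop :=
  ∀ (d : ℕ) (E : List Bool → (Fin d → ℕ) → ℕ) (a : Fin s), Evaluable (Token Loc) d E →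
    Evaluable (Token Loc) d fun x v => (decide (c x (E x v) = a)).toNat

/-- The function can be computed in polynomial time. -/
def EvaluableInput (N : List Bool → ℕ) : Prop :=
  ∀ d, Evaluable (Token Loc) d fun x _ => N x

theorem evaluable_levelSize (hW : EvaluableInput W) :
    EvaluableInput fun x => levelSize s (W x) :=
  fun d => (((hW d).add (.const 1)).mul (.const s)).add (.const 1)

variable {E : List Bool → (Fin d → ℕ) → ℕ}

/-- Each level contributes an `ite` whose last argument is the rest of the chain, so in prefix
notation the levels are simply concatenated. -/
theorem writable_fstF (hW : EvaluableInput W) (hk : EvaluableInput k) (hc : EvaluableRow c₀)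
    (hE : Evaluable (Token Loc) d E) (a : Fin s) :
    WritableFormula d fun x v => fstF (W x) (k x) (c₀ x) (E x v) a := by
  have hl := (Evaluable.var (O := Token Loc) (Fin.last d)).mul
    (evaluable_levelSize (s := s) hW (d + 1))
  exact (WritableContext.foldrRange (C := fun x v j φ => CTL.ite
      (CTL.bitF (j * levelSize s (W x))) (CTL.bitF (cellIdx s (W x) j (E x v) a)) φ) (hk d)
    (.ite (.bitF hl) (.bitF ((hl.add (.const 1)).add ((hE.weaken.mul (.const s)).add
      (.const a)))))).apply (.ofBool (hc d E a hE))

theorem writable_sndF (hW : EvaluableInput W) (hk : EvaluableInput k) (hc : EvaluableRow c₁)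
    (hE : Evaluable (Token Loc) d E) (a : Fin s) :
    WritableFormula d fun x v => sndF (W x) (k x) (c₁ x) (E x v) a := by
  have hl := (Evaluable.var (O := Token Loc) (Fin.last d)).mul
    (evaluable_levelSize (s := s) hW (d + 1))
  exact (WritableContext.foldrRange (C := fun x v j φ => CTL.ite
      (CTL.neg (CTL.bitF (j * levelSize s (W x)))) (CTL.bitF (cellIdx s (W x) j (E x v) a)) φ)
    (hk d) (.ite (WritableContext.neg.apply (.bitF hl)) (.bitF ((hl.add (.const 1)).add
      ((hE.weaken.mul (.const s)).add (.const a)))))).apply (.ofBool (hc d E a hE))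

variable (f : Fin s → Fin s → Fin s → Fin s → Fin s)

theorem writable_cellF (hW : EvaluableInput W) (hk : EvaluableInput k) (hc₀ : EvaluableRow c₀)
    (hc₁ : EvaluableRow c₁) (hE : Evaluable (Token Loc) d E) (a : Fin s) :
    WritableFormula d fun x v => cellF f (W x) (k x) (c₀ x) (c₁ x) (E x v) a := by
  refine (writable_sndF hW hk hc₁ hE a).iff ?_
  have h := fun i : Fin s × Fin s × Fin s × Fin s =>
    (WritableContext.conj (writable_fstF hW hk hc₀ (.const 0) i.1)).apply
      ((WritableContext.conj (writable_fstF hW hk hc₀ (hE.sub (.const 1)) i.2.1)).apply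
        ((WritableContext.conj (writable_fstF hW hk hc₀ hE i.2.2.1)).apply
          (writable_fstF hW hk hc₀ ((hE.add (.const 1)).min (hW d)) i.2.2.2)))
  exact ((WritableContext.foldrList (preimages f a) fun i => .disj (h i)).apply
    (.const (neg tru))).congr fun x v => by rw [bigDisj, List.foldr_map]

theorem writable_stepF (hW : EvaluableInput W) (hk : EvaluableInput k) (hc₀ : EvaluableRow c₀)
    (hc₁ : EvaluableRow c₁) :
    WritableFormula d fun x _ => stepF f (W x) (k x) (c₀ x) (c₁ x) := by
  have h := fun a => writable_cellF f hW hk hc₀ hc₁ (Evaluable.var (Fin.last d)) a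
  have h' := (WritableContext.foldrList (List.finRange s) fun a => .conj (h a)).apply (.const tru)
  exact ((WritableContext.foldrRange (C := fun x _ i φ => conj ((List.finRange s).foldr
    (fun a => conj (cellF f (W x) (k x) (c₀ x) (c₁ x) i a)) tru) φ)
    ((hW d).add (.const 1)) (.conj h')).apply (.const tru)).congr fun x v => by
      simp only [stepF, bigConj, List.foldr_map]

theorem writable_reachF (hW : EvaluableInput W) (hk : EvaluableInput k) (hc₀ : EvaluableRow c₀)
    (hc₁ : EvaluableRow c₁) :
    WritableFormula d fun x _ => reachF f (W x) (k x) (c₀ x) (c₁ x) (k x) := by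
  have key : ∀ W k (c₀ c₁ : ℕ → Fin s) j, reachF f W k c₀ c₁ j =
      (List.range j).foldr (fun o φ => exBlock ((j - 1 - o) * levelSize s W + 1) ((W + 1) * s)
        (allQ ((j - 1 - o) * levelSize s W) φ)) (stepF f W k c₀ c₁) := by
    intro W k c₀ c₁ j
    induction j with
    | zero => rfl
    | succ j ih =>
      rw [List.range_succ_eq_map, List.foldr_cons, List.foldr_map, reachF, ih]
      simp only [Nat.add_sub_cancel, Nat.sub_zero, Nat.succ_eq_add_one, Nat.sub_add_eq,
        Nat.sub_right_comm j _ 1]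
  have hl := (((hk (d + 1)).sub (.const 1)).sub (.var (Fin.last d))).mul
    (evaluable_levelSize (s := s) hW (d + 1))
  exact ((WritableContext.foldrRange (C := fun x _ o φ => exBlock
      ((k x - 1 - o) * levelSize s (W x) + 1) ((W x + 1) * s)
        (allQ ((k x - 1 - o) * levelSize s (W x)) φ)) (hk d)
    ((WritableContext.exBlock (hl.add (.const 1)) (((hW _).add (.const 1)).mul (.const s))).comp
      (.allQ hl))).apply (writable_stepF f hW hk hc₀ hc₁)).congr fun x v => (key _ _ _ _ _).symm

theorem evaluableRow_inputCell (z tt ff blank : Fin s) :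
    EvaluableRow fun x i => inputCell z tt ff blank x i := by
  intro d E a hE
  -- The digit test alone does not separate the input bit 0 from a position behind the input; the
  -- comparison with the length does.
  refine (Evaluable.cond hE.eqZero (.const (decide (z = a)).toNat)
    (.cond (hE.sub (.const 1)).digit (.const (decide (tt = a)).toNat)
      (.cond (Evaluable.length.sub (hE.sub (.const 1))).eqZero (.const (decide (blank = a)).toNat)
        (.const (decide (ff = a)).toNat)))).congr fun x v => ?_
  rcases Nat.eq_zero_or_pos (E x v) with h | h
  · simp [inputCell, h]
  · rcases lt_or_ge (E x v - 1) x.length with h' | h'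
    · have : x.length - (E x v - 1) ≠ 0 := by omega
      rcases hb : x[E x v - 1] <;> simp [inputCell, h.ne', hb, this, List.getElem?_eq_getElem h']
    · have : x.length - (E x v - 1) = 0 := by omega
      simp [inputCell, h.ne', this, List.getElem?_eq_none h']

theorem evaluableRow_outputCell (z o blank : Fin s) :
    EvaluableRow fun _ i => outputCell z o blank i := by
  intro d E a hE
  refine (Evaluable.cond hE.eqZero (.const (decide (z = a)).toNat)
    (.cond (hE.sub (.const 1)).eqZero (.const (decide (o = a)).toNat)
      (.const (decide (blank = a)).toNat))).congr fun x v => ?_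
  rcases Nat.eq_zero_or_pos (E x v) with h | h
  · simp [outputCell, h]
  · by_cases h' : E x v = 1
    · simp [outputCell, h']
    · have : E x v - 1 ≠ 0 := by omega
      simp [outputCell, h.ne', h', this]

end Reachability

end CTL

theorem theorem3 :
    fixedNet.IsNet ∧
      PSPACEHard (CTL.encode (P := Loc)) (fixedNet.modelChecking Loc.tbar 0) := by
  refine ⟨?_, fun L hL => ?_⟩
  · unfold OneCounterProcess.IsNet fixedNet
    simp [Set.insert_subset_iff]
  · obtain ⟨s, f, z₀, tt, ff, blank, z₁, o, p, h⟩ := hL.exists_localStep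
    have hW : CTL.EvaluableInput fun x => p.eval x.length := fun d => .polynomial p
    -- The number of levels is the exponent `s * (p.eval x.length + 1)` of the step count of the
    -- automaton.
    exact ⟨_, (CTL.writable_reachF f hW (fun d => (Evaluable.const s).mul
      ((hW d).add (.const 1))) (CTL.evaluableRow_inputCell z₀ tt ff blank)
      (CTL.evaluableRow_outputCell z₁ o blank)).polyTime,
      fun x => (h x).trans (CTL.sat_reachF f _ _ _).symm⟩
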